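/- **KL/Fisher control under Gaussian smoothing.** Let $d\ge 2$ be even, $R>0$ and $\gamma\in(0,R/2)$. Put $M=\lceil \pi R/\gamma\rceil$, let $\mathcal A=\{R(\cos(2\pi k/M),\sin(2\pi k/M)) : 0\le k<M\}\subset\mathbb R^2$, let $\mathcal V=\mathcal A^{d/2}\subset\mathbb R^d$ (one point of $\mathcal A$ in each pair of consecutive coordinates), and let $U$ be the uniform law on $\mathcal V$. A codebook is a tuple $S=(Y^{(1)},\dots,Y^{(n)})$, $n\ge1$, of points of $\mathcal V$; write $\nu_S=\frac1n\sum_{i=1}^n\delta_{Y^{(i)}}$. For $\tau>0$ let $\nu_{U,\tau}=U*\mathcal N(0,\tau^2I_d)$ and $\nu_{S,\tau}=\nu_S*\mathcal N(0,\tau^2I_d)$ (we use the same symbols for their smooth Lebesgue densities), let $u_\tau$ be the density of $\nu_{U,\tau}$, let $s_{S,\tau}=\nabla\log\nu_{S,\tau}$ and $s_{U,\tau}=\nabla\log u_\tau$, and let $J_\tau(S)=\mathbb E_{X\sim\nu_{S,\tau}}\|s_{S,\tau}(X)-s_{U,\tau}(X)\|_2^2$. For $t>0$ define $$D(t)=\mathrm{KL}(\nu_{S,\sqrt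 t}\,\|\,\nu_{U,\sqrt t}),\qquad J(t)=\int \nu_{S,\sqrt t}(x)\Big\|\nabla\log\frac{d\nu_{S,\sqrt t}}{d\nu_{U,\sqrt t}}(x)\Big\|_2^2dx,$$ $$\rho(t)=\sup_{x\in\mathbb R^d}\lambda_{\max}\big(\nabla^2\log u_{\sqrt t}(x)\big),\qquad \rho_+(t)=\max\{\rho(t),0\}.$$ There exist universal constants $C>0$ and $d_0$ such that, for all such $d,R,\gamma$ and every codebook $S$, the following hold. (a) For every $t>0$ the quantities $D(t)$, $J(t)$ and $\rho(t)$ are finite, and $D$ is differentiable at $t$ with $D'(t)=-\frac12J(t)$. For almost every $t>0$, $J$ is differentiable at $t$ and $J'(t)\le 2\rho_+(t)J(t)$. (b) For every $\alpha\in(0,1)$ and every $\tau>0$, $\rho_+$ is integrable on $[\alpha\tau^2,\tau^2]$ and $$J(\tau^2)\le\frac{2}{(1-\alpha)\tau^2}\exp\Big(2\int_{\alpha\tau^2}^{\tau^2}\rho_+(s)\,ds\Big)D(\alpha\tau^2).$$ (c) $\rho_+(t)\le R^2/t^2$ for every $t>0$. (d) If $d\ge d_0$, then for every $\tau\ge\gamma$,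 with $\alpha=1-\frac{\gamma^2}{R^2d^2}$ and $\widetilde\tau=\sqrt\alpha\,\tau$, the quantities $J_\tau(S)$ and $\mathrm{KL}(\nu_{S,\widetilde\tau}\,\|\,\nu_{U,\widetilde\tau})$ are finite and $$J_\tau(S)\le\frac{C R^2d^2}{\gamma^2\tau^2}\,\mathrm{KL}(\nu_{S,\widetilde\tau}\,\|\,\nu_{U,\widetilde\tau}).$$ -/

import Mathlib

open MeasureTheory ProbabilityTheory
open scoped ENNReal

namespace KLFisher

/-! ### Gaussian smoothing -/

/-- The isotropic Gaussian law `N(0, τ² I_d)` on `ℝ^d`. -/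
noncomputable def gaussianNoise (d : ℕ) (τ : ℝ) : Measure (EuclideanSpace ℝ (Fin d)) :=
  multivariateGaussian 0 (τ ^ 2 • (1 : Matrix (Fin d) (Fin d) ℝ))

/-- The smoothed law `ν_τ = ν * N(0, τ² I_d)`. -/
noncomputable def smoothed {d : ℕ} (ν : Measure (EuclideanSpace ℝ (Fin d))) (τ : ℝ) :
    Measure (EuclideanSpace ℝ (Fin d)) :=
  ν ∗ gaussianNoise d τ

/-- The Lebesgue density `φ_{τ²}` of `N(0, τ² I_d)`. -/
noncomputable def gaussianDensity (d : ℕ) (τ : ℝ) (x : EuclideanSpace ℝ (Fin d)) : ℝ :=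
  (2 * Real.pi * τ ^ 2) ^ (-((d : ℝ) / 2)) * Real.exp (-(‖x‖ ^ 2 / (2 * τ ^ 2)))

/-- The (everywhere defined, smooth) Lebesgue density
`x ↦ ∫ φ_{τ²}(x - y) ν(dy)` of `ν * N(0, τ² I_d)`. -/
noncomputable def density {d : ℕ} (ν : Measure (EuclideanSpace ℝ (Fin d))) (τ : ℝ)
    (x : EuclideanSpace ℝ (Fin d)) : ℝ :=
  ∫ y, gaussianDensity d τ (x - y) ∂ν

/-- The score `s_{ν,τ} = ∇ log ν_τ`. -/
noncomputable def score {d : ℕ} (ν : Measure (EuclideanSpace ℝ (Fin d))) (τ : ℝ)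
    (x : EuclideanSpace ℝ (Fin d)) : EuclideanSpace ℝ (Fin d) :=
  gradient (fun z => Real.log (density ν τ z)) x

/-! ### KL divergence, relative Fisher information and curvature along the heat flow -/

/-- `D(t) = KL(μ_{√t} ‖ ν_{√t})` as a real number. -/
noncomputable def klFlow {d : ℕ} (μ ν : Measure (EuclideanSpace ℝ (Fin d))) (t : ℝ) : ℝ :=
  (InformationTheory.klDiv (smoothed μ (Real.sqrt t)) (smoothed ν (Real.sqrt t))).toReal

/-- The integrand `μ_{√t}(x) ‖∇ log (dμ_{√t}/dν_{√t})(x)‖²` of the relative Fisher information. -/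
noncomputable def fisherIntegrand {d : ℕ} (μ ν : Measure (EuclideanSpace ℝ (Fin d))) (t : ℝ)
    (x : EuclideanSpace ℝ (Fin d)) : ℝ :=
  density μ (Real.sqrt t) x *
    ‖gradient (fun z => Real.log (density μ (Real.sqrt t) z / density ν (Real.sqrt t) z)) x‖ ^ 2

/-- `J(t) = ∫ μ_{√t}(x) ‖∇ log (dμ_{√t}/dν_{√t})(x)‖² dx`. -/
noncomputable def fisherFlow {d : ℕ} (μ ν : Measure (EuclideanSpace ℝ (Fin d))) (t : ℝ) : ℝ :=
  ∫ x, fisherIntegrand μ ν t x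

/-- `E_{X ∼ μ_τ} ‖s_{μ,τ}(X) - s_{ν,τ}(X)‖²`. -/
noncomputable def scoreError {d : ℕ} (μ ν : Measure (EuclideanSpace ℝ (Fin d))) (τ : ℝ) : ℝ :=
  ∫ x, ‖score μ τ x - score ν τ x‖ ^ 2 ∂(smoothed μ τ)

/-- The largest (real) eigenvalue of an endomorphism of `ℝ^d`. -/
noncomputable def lambdaMax {d : ℕ}
    (T : EuclideanSpace ℝ (Fin d) →L[ℝ] EuclideanSpace ℝ (Fin d)) : ℝ :=
  sSup {c : ℝ | Module.End.HasEigenvalue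
    (T : EuclideanSpace ℝ (Fin d) →ₗ[ℝ] EuclideanSpace ℝ (Fin d)) c}

/-- `λ_max(∇² log ν_{√t}(x))`, the Hessian being the derivative of the gradient. -/
noncomputable def maxCurvature {d : ℕ} (ν : Measure (EuclideanSpace ℝ (Fin d))) (t : ℝ)
    (x : EuclideanSpace ℝ (Fin d)) : ℝ :=
  lambdaMax (fderiv ℝ (gradient fun z => Real.log (density ν (Real.sqrt t) z)) x)

/-- `ρ(t) = sup_x λ_max(∇² log ν_{√t}(x))`. -/
noncomputable def rho {d : ℕ} (ν : Measure (EuclideanSpace ℝ (Fin d))) (t : ℝ) : ℝ :=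
  ⨆ x, maxCurvature ν t x

/-- `ρ₊(t) = max {ρ(t), 0}`. -/
noncomputable def rhoPlus {d : ℕ} (ν : Measure (EuclideanSpace ℝ (Fin d))) (t : ℝ) : ℝ :=
  max (rho ν t) 0

/-! ### The product-circle hard family, in dimension `d = 2 * m` -/

/-- `M = ⌈π R / γ⌉`. -/
noncomputable def numPoints (R γ : ℝ) : ℕ := ⌈Real.pi * (R / γ)⌉₊

/-- The set `𝒜` of the `M` equispaced points `R (cos (2πk/M), sin (2πk/M))`, `0 ≤ k < M`. -/
noncomputable def circlePoints (R γ : ℝ) : Set (EuclideanSpace ℝ (Fin 2)) :=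
  Set.range fun k : Fin (numPoints R γ) =>
    !₂[R * Real.cos (2 * Real.pi * (k : ℕ) / numPoints R γ),
       R * Real.sin (2 * Real.pi * (k : ℕ) / numPoints R γ)]

/-- The `j`-th planar block `(y_{2j}, y_{2j+1})` of `y ∈ ℝ^{2m}`. -/
noncomputable def block {m : ℕ} (y : EuclideanSpace ℝ (Fin (2 * m))) (j : Fin m) :
    EuclideanSpace ℝ (Fin 2) :=
  !₂[y ⟨2 * j, by omega⟩, y ⟨2 * j + 1, by omega⟩]

/-- The product support `𝒱 = 𝒜^{d/2}`. -/
def productCircle (m : ℕ) (R γ : ℝ) : Set (EuclideanSpace ℝ (Fin (2 * m))) :=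
  {y | ∀ j : Fin m, block y j ∈ circlePoints R γ}

/-- The uniform law `U` on `𝒱`. -/
noncomputable def nullLaw (m : ℕ) (R γ : ℝ) : Measure (EuclideanSpace ℝ (Fin (2 * m))) :=
  uniformOn (productCircle m R γ)

/-- The empirical law `ν_S = (1/n) ∑ᵢ δ_{S i}` of a codebook `S` of size `n`. -/
noncomputable def empirical {d n : ℕ} (S : Fin n → EuclideanSpace ℝ (Fin d)) :
    Measure (EuclideanSpace ℝ (Fin d)) :=
  (n : ℝ≥0∞)⁻¹ • ∑ i, Measure.dirac (S i)

end KLFisher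

namespace KLFisher

/-- `gaussianDensity d τ` is the Lebesgue density of `N(0, τ² I_d)`. -/
theorem gaussianNoise_eq_withDensity (d : ℕ) {τ : ℝ} (hτ : 0 < τ) :
    gaussianNoise d τ = volume.withDensity fun x => ENNReal.ofReal (gaussianDensity d τ x) := by
  have hb : 0 < (1 / (2 * τ ^ 2) : ℝ) := by positivity
  have hnn : ∀ x, 0 ≤ gaussianDensity d τ x := fun x => by unfold gaussianDensity; positivity
  have hmeas : Measurable (gaussianDensity d τ) := by unfold gaussianDensity; fun_prop
  have hint1 : ∫ x, gaussianDensity d τ x = 1 := by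
    have h := GaussianFourier.integral_rexp_neg_mul_sq_norm (V := EuclideanSpace ℝ (Fin d)) hb
    unfold gaussianDensity
    rw [integral_const_mul]
    have : ∀ x : EuclideanSpace ℝ (Fin d), -(‖x‖ ^ 2 / (2 * τ ^ 2)) =
        -(1 / (2 * τ ^ 2)) * ‖x‖ ^ 2 := fun x => by ring
    simp_rw [this]
    rw [h, finrank_euclideanSpace_fin,
      show Real.pi / (1 / (2 * τ ^ 2)) = 2 * Real.pi * τ ^ 2 by field_simp,
      ← Real.rpow_add (by positivity)]
    simp
  have hint : Integrable (gaussianDensity d τ) := by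
    by_contra h
    rw [integral_undef h] at hint1
    exact zero_ne_one hint1
  have hfin : IsFiniteMeasure
      (volume.withDensity fun x => ENNReal.ofReal (gaussianDensity d τ x)) :=
    isFiniteMeasure_withDensity_ofReal hint.2
  have : IsFiniteMeasure (gaussianNoise d τ) := by unfold gaussianNoise; infer_instance
  refine Measure.ext_of_charFun (funext fun t => ?_)
  have hps : (τ ^ 2 • (1 : Matrix (Fin d) (Fin d) ℝ)).PosSemidef :=
    Matrix.PosSemidef.one.smul (sq_nonneg τ)
  rw [gaussianNoise, charFun_multivariateGaussian hps, charFun_apply,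
    integral_withDensity_eq_integral_toReal_smul (by fun_prop) (by simp)]
  have hc := GaussianFourier.integral_cexp_neg_mul_sq_norm_add (V := EuclideanSpace ℝ (Fin d))
    (b := ((1 / (2 * τ ^ 2) : ℝ) : ℂ)) (by rw [Complex.ofReal_re]; exact hb) Complex.I t
  have hfun : ∀ x : EuclideanSpace ℝ (Fin d),
      (ENNReal.ofReal (gaussianDensity d τ x)).toReal • Complex.exp ((inner ℝ x t : ℝ) * Complex.I) =
      (((2 * Real.pi * τ ^ 2) ^ (-((d : ℝ) / 2)) : ℝ) : ℂ) *
        Complex.exp (-((1 / (2 * τ ^ 2) : ℝ) : ℂ) * ‖x‖ ^ 2 + Complex.I * (inner ℝ t x : ℝ)) := by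
    intro x
    rw [ENNReal.toReal_ofReal (hnn x), gaussianDensity, Complex.exp_add, real_inner_comm x t,
      Complex.real_smul]
    push_cast
    rw [mul_assoc]
    congr 3
    · ring
    · ring
  simp_rw [hfun]
  rw [integral_const_mul, hc, finrank_euclideanSpace_fin, ← mul_assoc]
  have h1 : (((2 * Real.pi * τ ^ 2) ^ (-((d : ℝ) / 2)) : ℝ) : ℂ) *
      ((Real.pi : ℂ) / ((1 / (2 * τ ^ 2) : ℝ) : ℂ)) ^ ((d : ℂ) / 2) = 1 := by
    rw [← Complex.ofReal_div, show Real.pi / (1 / (2 * τ ^ 2)) = 2 * Real.pi * τ ^ 2 by field_simp,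
      show ((d : ℂ) / 2) = (((d : ℝ) / 2 : ℝ) : ℂ) by push_cast; rfl,
      ← Complex.ofReal_cpow (by positivity), ← Complex.ofReal_mul, ← Real.rpow_add (by positivity)]
    simp
  rw [h1, one_mul]
  have hdot : t.ofLp ⬝ᵥ (τ ^ 2 • (1 : Matrix (Fin d) (Fin d) ℝ)).mulVec t.ofLp
      = τ ^ 2 * ‖t‖ ^ 2 := by
    rw [Matrix.smul_mulVec, Matrix.one_mulVec, dotProduct_smul, EuclideanSpace.real_norm_sq_eq]
    simp [dotProduct, sq]
  rw [hdot]
  congr 1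
  have : (τ : ℂ) ≠ 0 := by exact_mod_cast hτ.ne'
  simp only [inner_zero_right, Complex.I_sq]
  push_cast
  field_simp
  ring

/-- `density ν τ` is the Lebesgue density of `ν * N(0, τ² I_d)`. -/
theorem smoothed_eq_withDensity {d : ℕ} (ν : Measure (EuclideanSpace ℝ (Fin d)))
    [IsFiniteMeasure ν] {τ : ℝ} (hτ : 0 < τ) :
    smoothed ν τ = volume.withDensity fun x => ENNReal.ofReal (density ν τ x) := by
  have hnn : ∀ x, 0 ≤ gaussianDensity d τ x := fun x => by unfold gaussianDensity; positivity
  have hmeas : Measurable (gaussianDensity d τ) := by unfold gaussianDensity; fun_prop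
  have hle : ∀ x, gaussianDensity d τ x ≤ (2 * Real.pi * τ ^ 2) ^ (-((d : ℝ) / 2)) := fun x => by
    unfold gaussianDensity
    refine mul_le_of_le_one_right (by positivity) (Real.exp_le_one_iff.2 ?_)
    have : 0 ≤ ‖x‖ ^ 2 / (2 * τ ^ 2) := by positivity
    linarith
  have hden : ∀ x, ENNReal.ofReal (density ν τ x) =
      ∫⁻ y, ENNReal.ofReal (gaussianDensity d τ (x - y)) ∂ν := fun x => by
    refine ofReal_integral_eq_lintegral_ofReal ?_ (Filter.Eventually.of_forall fun y => hnn _)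
    refine Integrable.of_bound (C := (2 * Real.pi * τ ^ 2) ^ (-((d : ℝ) / 2)))
      (hmeas.comp (measurable_const.sub measurable_id)).aestronglyMeasurable
      (Filter.Eventually.of_forall fun y => ?_)
    rw [Real.norm_of_nonneg (hnn _)]
    exact hle _
  have : IsFiniteMeasure (gaussianNoise d τ) := by unfold gaussianNoise; infer_instance
  refine Measure.ext_of_lintegral _ fun f hf => ?_
  simp_rw [hden]
  rw [smoothed, Measure.lintegral_conv hf, lintegral_withDensity_eq_lintegral_mul₀
    (by fun_prop) hf.aemeasurable]
  simp_rw [gaussianNoise_eq_withDensity d hτ, Pi.mul_apply]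
  have h2 : ∀ y, ∫⁻ z, f (y + z) ∂(volume.withDensity fun x =>
      ENNReal.ofReal (gaussianDensity d τ x)) =
      ∫⁻ x, ENNReal.ofReal (gaussianDensity d τ (x - y)) * f x := fun y => by
    rw [lintegral_withDensity_eq_lintegral_mul₀ (by fun_prop) (by fun_prop)]
    rw [← lintegral_add_left_eq_self (fun x => ENNReal.ofReal (gaussianDensity d τ (x - y)) * f x) y]
    simp
  simp_rw [h2]
  rw [lintegral_lintegral_swap (by fun_prop)]
  refine lintegral_congr fun x => ?_
  rw [lintegral_mul_const _ (by fun_prop)]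

theorem productCircle_finite (m : ℕ) (R γ : ℝ) : (productCircle m R γ).Finite := by
  have h : (Set.pi Set.univ fun _ : Fin m => circlePoints R γ).Finite :=
    Set.Finite.pi fun _ => Set.finite_range _
  refine Set.Finite.of_finite_image (f := fun y => block y) (h.subset ?_) ?_
  · rintro _ ⟨y, hy, rfl⟩ j _
    exact hy j
  · intro y _ z _ hyz
    ext i
    have hj := congrFun hyz ⟨i / 2, by omega⟩
    rcases Nat.mod_two_eq_zero_or_one i with h | h
    · have h0 : y ⟨2 * (i / 2), by omega⟩ = z ⟨2 * (i / 2), by omega⟩ :=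
        congrArg (fun v : EuclideanSpace ℝ (Fin 2) => v 0) hj
      have hi : i = ⟨2 * (i / 2), by omega⟩ := Fin.ext (by simp; omega)
      rw [hi]
      exact h0
    · have h1 : y ⟨2 * (i / 2) + 1, by omega⟩ = z ⟨2 * (i / 2) + 1, by omega⟩ :=
        congrArg (fun v : EuclideanSpace ℝ (Fin 2) => v 1) hj
      have hi : i = ⟨2 * (i / 2) + 1, by omega⟩ := Fin.ext (by simp; omega)
      rw [hi]
      exact h1

theorem productCircle_nonempty (m : ℕ) {R γ : ℝ} (hR : 0 < R) (hγ : 0 < γ) :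
    (productCircle m R γ).Nonempty := by
  have hM : 0 < numPoints R γ := Nat.ceil_pos.2 (by positivity)
  refine ⟨WithLp.toLp 2 fun i => if (i : ℕ) % 2 = 0 then R else 0, fun j => ⟨⟨0, hM⟩, ?_⟩⟩
  ext k
  fin_cases k <;> simp [block, Nat.add_mod]

end KLFisher

/-! All points of `productCircle` have norm r = `√(m * R ^ 2)`, so the codebook law P and the null
law Q are mixtures carried by the same sphere. Expanding |x - y|² in the Gaussian kernel leaves,
with z = x/t, a factor common to both densities times the Laplace transform of the mixture at z. The
log-ratio of the densities is therefore a difference of log-Laplace transforms; in z its gradient is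
δ = m_P - m_Q, the difference of the tilted (posterior) means, and its Hessian is H = Σ_P - Σ_Q, the
difference of the tilted covariances.

In the time s = 1/t, z is distributed as sY + √s Z, a Brownian motion with drift Y at time s, and Y
has conditional mean m_P(z). Hence d/ds E h(z) = E[⟨∇h, m_P⟩ + ½Δh] (`IsLaw.hasDerivAt_average`). On
a sphere tr Σ = r² - |m|², so for h = log-ratio the bracket is ½|δ|², which is de Bruijn's identity
(`IsLaw.hasDerivAt_klFlow`). For h = |δ|² it is ‖H‖²_HS - 2⟨Σ_Q δ, δ⟩. Dropping the square gives J'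
≤ 2(Λ/t² - 1/t)J whenever Σ_Q ≤ Λ everywhere (`IsLaw.hasDerivAt_fisherFlow`), and the best Λ makes
the bracket equal to ρ(t) (`IsLaw.rho_eq`).

The integrated inequality follows from the mean value theorem for D and Gronwall for J
(`le_mul_exp_integral_mul_of_deriv`). For the curvature bound, the Laplace transform of the null law
factors over planar blocks, so Σ_Q is block diagonal and each block is a covariance on a circle of
radius R; thus Λ ≤ R² in every dimension. With the prescribed α the exponent in the integrated
inequality is at most 1, which gives C = 2e. -/

namespace KLFisher

/-! ### Exponential families of finite mixtures on a sphere -/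

/-- A probability vector `w` on finitely many points `Y i` of the sphere of radius `r`. -/
structure SphereMixture (V : Type*) [NormedAddCommGroup V] [InnerProductSpace ℝ V]
    (ι : Type*) [Fintype ι] where
  w : ι → ℝ
  Y : ι → V
  r : ℝ
  w_pos : ∀ i, 0 < w i
  sum_w : ∑ i, w i = 1
  norm_Y : ∀ i, ‖Y i‖ = r

namespace SphereMixture

variable {V : Type*} [NormedAddCommGroup V] [InnerProductSpace ℝ V] {ι : Type*} [Fintype ι]
  (P : SphereMixture V ι)

local notation "⟪" x ", " y "⟫" => inner ℝ x y

/-- The Laplace transform of the mixture. -/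
noncomputable def laplace (z : V) : ℝ := ∑ i, P.w i * Real.exp ⟪P.Y i, z⟫

/-- The weights of the mixture tilted by `z`. -/
noncomputable def post (z : V) (i : ι) : ℝ := P.w i * Real.exp ⟪P.Y i, z⟫ / P.laplace z

/-- The mean of the tilted mixture. -/
noncomputable def mean (z : V) : V := ∑ i, P.post z i • P.Y i

/-- The covariance operator of the tilted mixture. -/
noncomputable def cov (z : V) : V →L[ℝ] V :=
  ∑ i, P.post z i • (innerSL ℝ (P.Y i - P.mean z)).smulRight (P.Y i)

theorem cov_apply (z v : V) :
    P.cov z v = ∑ i, (P.post z i * ⟪P.Y i - P.mean z, v⟫) • P.Y i := by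
  simp only [cov, sum_apply, smul_apply, ContinuousLinearMap.smulRight_apply,
    innerSL_apply_apply, mul_smul]

theorem nonempty (P : SphereMixture V ι) : Nonempty ι := by
  by_contra h
  rw [not_nonempty_iff] at h
  simpa using P.sum_w

theorem r_nonneg : 0 ≤ P.r := by
  obtain ⟨i⟩ := P.nonempty
  rw [← P.norm_Y i]
  exact norm_nonneg _

theorem laplace_pos (z : V) : 0 < P.laplace z := by
  have := P.nonempty
  exact Finset.sum_pos (fun i _ => mul_pos (P.w_pos i) (Real.exp_pos _)) Finset.univ_nonempty

theorem post_pos (z : V) (i : ι) : 0 < P.post z i :=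
  div_pos (mul_pos (P.w_pos i) (Real.exp_pos _)) (P.laplace_pos z)

theorem sum_post (z : V) : ∑ i, P.post z i = 1 := by
  simp only [post]
  rw [← Finset.sum_div]
  exact div_self (P.laplace_pos z).ne'

theorem norm_mean_le (z : V) : ‖P.mean z‖ ≤ P.r := by
  refine (norm_sum_le _ _).trans ?_
  simp_rw [norm_smul, P.norm_Y, Real.norm_of_nonneg (P.post_pos z _).le]
  rw [← Finset.sum_mul, P.sum_post, one_mul]

theorem norm_sub_mean_le (z : V) (i : ι) : ‖P.Y i - P.mean z‖ ≤ 2 * P.r := by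
  have h1 := norm_sub_le (P.Y i) (P.mean z)
  have h2 := P.norm_mean_le z
  rw [P.norm_Y] at h1
  linarith

theorem sum_post_mul_sub_mean (z v : V) : ∑ i, P.post z i * ⟪P.Y i - P.mean z, v⟫ = 0 := by
  simp_rw [inner_sub_left, mul_sub]
  rw [Finset.sum_sub_distrib, ← Finset.sum_mul, P.sum_post, one_mul]
  simp_rw [← real_inner_smul_left]
  rw [← sum_inner, ← mean, sub_self]

/-- Only one factor in `cov` is centred; centring the other is free because the centred inner
products average to zero. Symmetry and nonnegativity become visible. -/
theorem inner_cov (z u v : V) :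
    ⟪P.cov z u, v⟫ = ∑ i, P.post z i * ⟪P.Y i - P.mean z, u⟫ * ⟪P.Y i - P.mean z, v⟫ := by
  rw [cov_apply, sum_inner]
  simp_rw [real_inner_smul_left, inner_sub_left (P.Y _) (P.mean z) v, mul_sub]
  rw [Finset.sum_sub_distrib, ← Finset.sum_mul, P.sum_post_mul_sub_mean, zero_mul, sub_zero]

theorem inner_cov_comm (z u v : V) : ⟪P.cov z u, v⟫ = ⟪P.cov z v, u⟫ := by
  simp_rw [inner_cov]
  exact Finset.sum_congr rfl fun i _ => by ring

/-- A variance is at most the second moment, which Cauchy–Schwarz bounds on the sphere. -/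
theorem inner_cov_self_le (z v : V) : ⟪P.cov z v, v⟫ ≤ P.r ^ 2 * ‖v‖ ^ 2 := by
  have h : ⟪P.cov z v, v⟫ = ∑ i, P.post z i * ⟪P.Y i, v⟫ ^ 2 - ⟪P.mean z, v⟫ ^ 2 := by
    have h1 : ∑ i, P.post z i * ⟪P.Y i, v⟫ = ⟪P.mean z, v⟫ := by
      rw [mean, sum_inner]
      simp_rw [real_inner_smul_left]
    rw [inner_cov]
    have : ∀ i, P.post z i * ⟪P.Y i - P.mean z, v⟫ * ⟪P.Y i - P.mean z, v⟫ =
        P.post z i * ⟪P.Y i, v⟫ ^ 2 - 2 * ⟪P.mean z, v⟫ * (P.post z i * ⟪P.Y i, v⟫) +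
        P.post z i * ⟪P.mean z, v⟫ ^ 2 := fun i => by rw [inner_sub_left]; ring
    simp_rw [this]
    rw [Finset.sum_add_distrib, Finset.sum_sub_distrib, ← Finset.mul_sum, h1, ← Finset.sum_mul,
      P.sum_post]
    ring
  have h2 : ∑ i, P.post z i * ⟪P.Y i, v⟫ ^ 2 ≤ ∑ i, P.post z i * (P.r ^ 2 * ‖v‖ ^ 2) := by
    refine Finset.sum_le_sum fun i _ => mul_le_mul_of_nonneg_left ?_ (P.post_pos z i).le
    rw [← mul_pow, ← P.norm_Y i, ← sq_abs]
    exact pow_le_pow_left₀ (abs_nonneg _) (abs_real_inner_le_norm _ _) 2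
  rw [← Finset.sum_mul, P.sum_post, one_mul] at h2
  nlinarith [sq_nonneg ⟪P.mean z, v⟫]

theorem hasFDerivAt_laplace (z : V) :
    HasFDerivAt P.laplace (P.laplace z • innerSL ℝ (P.mean z)) z := by
  have h : HasFDerivAt P.laplace
      (∑ i, P.w i • (Real.exp ⟪P.Y i, z⟫ • innerSL ℝ (P.Y i))) z := by
    refine HasFDerivAt.fun_sum fun i _ => ?_
    exact ((innerSL ℝ (P.Y i)).hasFDerivAt.exp).const_mul (P.w i)
  convert h using 1
  ext v
  have := (P.laplace_pos z).ne'
  simp only [mean, smul_apply, sum_apply, sum_inner,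
    innerSL_apply_apply, real_inner_smul_left, smul_eq_mul, Finset.mul_sum, post]
  refine Finset.sum_congr rfl fun i _ => ?_
  field_simp

theorem hasFDerivAt_log_laplace (z : V) :
    HasFDerivAt (fun x => Real.log (P.laplace x)) (innerSL ℝ (P.mean z)) z := by
  have := (P.hasFDerivAt_laplace z).log (P.laplace_pos z).ne'
  rwa [smul_smul, inv_mul_cancel₀ (P.laplace_pos z).ne', one_smul] at this

theorem hasFDerivAt_post (z : V) (i : ι) :
    HasFDerivAt (fun x => P.post x i) (P.post z i • innerSL ℝ (P.Y i - P.mean z)) z := by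
  -- In exponential form the logarithmic derivative of the weight is immediately `Y i` minus the
  -- mean.
  have hp : ∀ x, P.post x i = P.w i * Real.exp (⟪P.Y i, x⟫ - Real.log (P.laplace x)) := fun x => by
    rw [Real.exp_sub, Real.exp_log (P.laplace_pos x), post, mul_div_assoc]
  have h := ((((innerSL ℝ (P.Y i)).hasFDerivAt (x := z)).sub
    (P.hasFDerivAt_log_laplace z)).exp).const_mul (P.w i)
  refine (h.congr_fderiv ?_).congr_of_eventuallyEq (Filter.Eventually.of_forall hp)
  rw [hp, map_sub, smul_smul]
  rfl

theorem hasFDerivAt_mean (z : V) : HasFDerivAt P.mean (P.cov z) z := by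
  have h : HasFDerivAt P.mean
      (∑ i, (P.post z i • innerSL ℝ (P.Y i - P.mean z)).smulRight (P.Y i)) z :=
    HasFDerivAt.fun_sum fun i _ => (P.hasFDerivAt_post z i).smul_const (P.Y i)
  refine h.congr_fderiv ?_
  ext v
  simp [cov, mul_smul]

@[fun_prop]
theorem continuous_mean : Continuous P.mean :=
  continuous_iff_continuousAt.2 fun z => (P.hasFDerivAt_mean z).continuousAt

@[fun_prop]
theorem continuous_post (i : ι) : Continuous fun z => P.post z i :=
  continuous_iff_continuousAt.2 fun z => (P.hasFDerivAt_post z i).continuousAt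

theorem continuous_cov_apply {f : V → V} (hf : Continuous f) :
    Continuous fun z => P.cov z (f z) := by
  simp_rw [cov_apply]
  fun_prop

theorem norm_cov_apply_le (z v : V) : ‖P.cov z v‖ ≤ 2 * P.r ^ 2 * ‖v‖ := by
  rw [cov_apply]
  refine (norm_sum_le _ _).trans ?_
  have : ∀ i, ‖(P.post z i * ⟪P.Y i - P.mean z, v⟫) • P.Y i‖ ≤
      P.post z i * (2 * P.r ^ 2 * ‖v‖) := fun i => by
    rw [norm_smul, norm_mul, P.norm_Y, Real.norm_of_nonneg (P.post_pos z i).le, mul_assoc]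
    refine mul_le_mul_of_nonneg_left ?_ (P.post_pos z i).le
    have h1 := norm_inner_le_norm (𝕜 := ℝ) (P.Y i - P.mean z) v
    have h2 := P.norm_sub_mean_le z i
    calc _ ≤ (2 * P.r * ‖v‖) * P.r := by
          refine mul_le_mul_of_nonneg_right (h1.trans ?_) P.r_nonneg
          gcongr
      _ = _ := by ring
  refine (Finset.sum_le_sum fun i _ => this i).trans ?_
  rw [← Finset.sum_mul, P.sum_post, one_mul]

/-- The weighted third-order term occurring in the derivative of the covariance. -/
noncomputable def third (z u v : V) : V :=
  ∑ i, (P.post z i * (⟪P.Y i - P.mean z, u⟫ * ⟪P.Y i - P.mean z, v⟫)) • P.Y i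

/-- Three things move: the tilted weights (the `third` term), the vector `f`, and the centre `mean`,
whose motion gives the subtracted term. -/
theorem hasDerivAt_cov_apply {c f : ℝ → V} {c' f' : V} {t : ℝ} (hc : HasDerivAt c c' t)
    (hf : HasDerivAt f f' t) :
    HasDerivAt (fun ε => P.cov (c ε) (f ε))
      (P.third (c t) c' (f t) + P.cov (c t) f' - ⟪P.cov (c t) c', f t⟫ • P.mean (c t)) t := by
  simp_rw [fun ε => P.cov_apply (c ε) (f ε)]
  have hm : HasDerivAt (fun ε => P.mean (c ε)) (P.cov (c t) c') t :=
    (P.hasFDerivAt_mean (c t)).comp_hasDerivAt t hc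
  have hp : ∀ i, HasDerivAt (fun ε => P.post (c ε) i)
      (P.post (c t) i * ⟪P.Y i - P.mean (c t), c'⟫) t := fun i =>
    (P.hasFDerivAt_post (c t) i).comp_hasDerivAt t hc
  have hi : ∀ i, HasDerivAt (fun ε => ⟪P.Y i - P.mean (c ε), f ε⟫)
      (⟪P.Y i - P.mean (c t), f'⟫ + ⟪-P.cov (c t) c', f t⟫) t := fun i =>
    (hm.const_sub (P.Y i)).inner ℝ hf
  refine (HasDerivAt.fun_sum (u := Finset.univ)
    fun i _ => ((hp i).mul (hi i)).smul_const (P.Y i)).congr_deriv ?_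
  rw [third, cov_apply P (c t) f', mean, Finset.smul_sum, ← Finset.sum_add_distrib,
    ← Finset.sum_sub_distrib]
  refine Finset.sum_congr rfl fun i _ => ?_
  rw [← mean, smul_smul, ← add_smul, ← sub_smul, inner_neg_left]
  congr 1
  ring

theorem norm_third_le (z u v : V) : ‖P.third z u v‖ ≤ 4 * P.r ^ 3 * (‖u‖ * ‖v‖) := by
  rw [third]
  refine (norm_sum_le _ _).trans ?_
  have : ∀ i, ‖(P.post z i * (⟪P.Y i - P.mean z, u⟫ * ⟪P.Y i - P.mean z, v⟫)) • P.Y i‖ ≤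
      P.post z i * (4 * P.r ^ 3 * (‖u‖ * ‖v‖)) := fun i => by
    rw [norm_smul, norm_mul, norm_mul, P.norm_Y, Real.norm_of_nonneg (P.post_pos z i).le, mul_assoc]
    refine mul_le_mul_of_nonneg_left ?_ (P.post_pos z i).le
    have hr := P.r_nonneg
    have h2 := P.norm_sub_mean_le z i
    have hu := (norm_inner_le_norm (𝕜 := ℝ) (P.Y i - P.mean z) u).trans
      (mul_le_mul_of_nonneg_right h2 (norm_nonneg u))
    have hv := (norm_inner_le_norm (𝕜 := ℝ) (P.Y i - P.mean z) v).trans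
      (mul_le_mul_of_nonneg_right h2 (norm_nonneg v))
    calc _ ≤ ((2 * P.r * ‖u‖) * (2 * P.r * ‖v‖)) * P.r := by gcongr
      _ = _ := by ring
  refine (Finset.sum_le_sum fun i _ => this i).trans ?_
  rw [← Finset.sum_mul, P.sum_post, one_mul]

/-! ### Traces over an orthonormal basis -/

section Trace

variable {κ : Type*} [Fintype κ] (b : OrthonormalBasis κ ℝ V)

/-- Parseval reduces the trace to an average involving ⟨Y - m, Y⟩ = r² - ⟨m, Y⟩. As r² is the same
for all atoms, centring removes it. -/
theorem sum_inner_third (z v : V) :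
    ∑ k, ⟪P.third z (b k) v, b k⟫ = -⟪P.cov z v, P.mean z⟫ := by
  have h : ∀ k, ⟪P.third z (b k) v, b k⟫ = ∑ i, P.post z i * ⟪P.Y i - P.mean z, v⟫ *
      (⟪P.Y i - P.mean z, b k⟫ * ⟪b k, P.Y i⟫) := fun k => by
    rw [third, sum_inner]
    refine Finset.sum_congr rfl fun i _ => ?_
    rw [real_inner_smul_left, real_inner_comm (P.Y i) (b k)]
    ring
  simp_rw [h]
  rw [Finset.sum_comm]
  simp_rw [← Finset.mul_sum, b.sum_inner_mul_inner, inner_sub_left (P.Y _) _ (P.Y _),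
    real_inner_self_eq_norm_sq, P.norm_Y, mul_sub]
  rw [Finset.sum_sub_distrib, ← Finset.sum_mul, P.sum_post_mul_sub_mean, cov_apply, sum_inner]
  simp_rw [real_inner_smul_left, real_inner_comm (P.mean z)]
  simp

/-- The total variance of a vector of constant norm. For two mixtures on one sphere the r² cancels,
leaving only the means in the Laplacian of the log-ratio. -/
theorem sum_inner_cov (z : V) : ∑ k, ⟪P.cov z (b k), b k⟫ = P.r ^ 2 - ‖P.mean z‖ ^ 2 := by
  have h : ∀ k, ⟪P.cov z (b k), b k⟫ =
      ∑ i, P.post z i * (⟪P.Y i - P.mean z, b k⟫ * ⟪b k, P.Y i⟫) := fun k => by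
    rw [cov_apply, sum_inner]
    refine Finset.sum_congr rfl fun i _ => ?_
    rw [real_inner_smul_left, real_inner_comm (P.Y i) (b k)]
    ring
  simp_rw [h]
  rw [Finset.sum_comm]
  simp_rw [← Finset.mul_sum, b.sum_inner_mul_inner, inner_sub_left (P.Y _) _ (P.Y _),
    real_inner_self_eq_norm_sq, P.norm_Y, mul_sub]
  rw [Finset.sum_sub_distrib, ← Finset.sum_mul, P.sum_post, one_mul, ← real_inner_self_eq_norm_sq (P.mean z)]
  simp_rw [← real_inner_smul_right]
  rw [← inner_sum, ← mean]

end Trace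

end SphereMixture

end KLFisher

namespace KLFisher

/-! ### Gaussian averages: integration by parts and the heat equation -/

section Gaussian

variable {d : ℕ}

local notation "⟪" x ", " y "⟫" => inner ℝ x y

instance isGaussian_gaussianNoise (d : ℕ) (τ : ℝ) : IsGaussian (gaussianNoise d τ) := by
  unfold gaussianNoise
  infer_instance

theorem gaussianDensity_pos (d : ℕ) {τ : ℝ} (hτ : 0 < τ) (x : EuclideanSpace ℝ (Fin d)) :
    0 < gaussianDensity d τ x := by
  unfold gaussianDensity
  positivity

@[fun_prop]
theorem continuous_gaussianDensity (d : ℕ) (τ : ℝ) : Continuous (gaussianDensity d τ) := by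
  unfold gaussianDensity
  fun_prop

theorem integral_gaussianNoise {τ : ℝ} (hτ : 0 < τ) (F : EuclideanSpace ℝ (Fin d) → ℝ) :
    ∫ z, F z ∂gaussianNoise d τ = ∫ z, gaussianDensity d τ z * F z := by
  rw [gaussianNoise_eq_withDensity d hτ, integral_withDensity_eq_integral_toReal_smul
    (continuous_gaussianDensity d τ).measurable.ennreal_ofReal (by simp)]
  simp_rw [ENNReal.toReal_ofReal (gaussianDensity_pos d hτ _).le, smul_eq_mul]

theorem integrable_gaussianNoise_iff {τ : ℝ} (hτ : 0 < τ) (F : EuclideanSpace ℝ (Fin d) → ℝ) :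
    Integrable F (gaussianNoise d τ) ↔ Integrable (fun z => gaussianDensity d τ z * F z) := by
  rw [gaussianNoise_eq_withDensity d hτ, integrable_withDensity_iff_integrable_smul'
    (continuous_gaussianDensity d τ).measurable.ennreal_ofReal (by simp)]
  simp_rw [ENNReal.toReal_ofReal (gaussianDensity_pos d hτ _).le, smul_eq_mul]

theorem hasLineDerivAt_gaussianDensity (d : ℕ) (z v : EuclideanSpace ℝ (Fin d)) :
    HasLineDerivAt ℝ (gaussianDensity d 1) (-(gaussianDensity d 1 z * ⟪z, v⟫)) z v := by
  have h1 : HasFDerivAt (fun x : EuclideanSpace ℝ (Fin d) => ‖x‖ ^ 2) (2 • innerSL ℝ z) z :=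
    (hasStrictFDerivAt_norm_sq z).hasFDerivAt
  have h2 := (((h1.mul_const ((2 * 1 ^ 2 : ℝ)⁻¹)).neg).exp).const_mul
    ((2 * Real.pi * 1 ^ 2) ^ (-((d : ℝ) / 2)))
  have h3 := h2.hasLineDerivAt v
  rw [HasLineDerivAt] at h3 ⊢
  refine (h3.congr_deriv ?_).congr_of_eventuallyEq (Filter.Eventually.of_forall fun ε => ?_)
  · simp only [gaussianDensity, smul_apply, neg_apply, innerSL_apply_apply, smul_eq_mul,
      nsmul_eq_mul, div_eq_mul_inv, Pi.neg_apply]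
    push_cast
    ring
  · simp only [gaussianDensity, div_eq_mul_inv, Pi.neg_apply]

theorem integrable_norm_gaussianNoise (d : ℕ) (τ : ℝ) :
    Integrable (fun z : EuclideanSpace ℝ (Fin d) => ‖z‖) (gaussianNoise d τ) :=
  ((IsGaussian.memLp_id (gaussianNoise d τ) 1 (by simp)).integrable le_rfl).norm

/-- Gaussian integration by parts. -/
theorem integral_mul_inner_gaussianNoise {f f' : EuclideanSpace ℝ (Fin d) → ℝ}
    {v : EuclideanSpace ℝ (Fin d)} {C K : ℝ} (hf : Measurable f) (hfC : ∀ x, |f x| ≤ C)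
    (hf' : Measurable f') (hfK : ∀ x, |f' x| ≤ K) (h : ∀ x, HasLineDerivAt ℝ f (f' x) x v) :
    ∫ z, f z * ⟪z, v⟫ ∂gaussianNoise d 1 = ∫ z, f' z ∂gaussianNoise d 1 := by
  have i1 : Integrable f' (gaussianNoise d 1) :=
    Integrable.of_bound hf'.aestronglyMeasurable K (Filter.Eventually.of_forall hfK)
  have i2 : Integrable f (gaussianNoise d 1) :=
    Integrable.of_bound hf.aestronglyMeasurable C (Filter.Eventually.of_forall hfC)
  have i3 : Integrable (fun z => f z * ⟪z, v⟫) (gaussianNoise d 1) := by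
    refine ((integrable_norm_gaussianNoise d 1).mul_const (C * ‖v‖)).mono'
      (by fun_prop) (Filter.Eventually.of_forall fun z => ?_)
    rw [norm_mul]
    have h1 := norm_inner_le_norm (𝕜 := ℝ) z v
    calc _ ≤ C * (‖z‖ * ‖v‖) := mul_le_mul (hfC z) h1 (norm_nonneg _) ((abs_nonneg _).trans (hfC z))
      _ = _ := by ring
  rw [integrable_gaussianNoise_iff one_pos] at i1 i2 i3
  rw [integral_gaussianNoise one_pos, integral_gaussianNoise one_pos]
  have i4 : Integrable (fun z => -(gaussianDensity d 1 z * ⟪z, v⟫) * f z) := by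
    refine i3.neg.congr (Filter.Eventually.of_forall fun z => ?_)
    simp only [Pi.neg_apply]
    ring
  -- The derivative falls on the Gaussian density and produces the factor -⟨z, v⟩.
  have := integral_bilinear_hasLineDerivAt_right_eq_neg_left_of_integrable (μ := volume)
    (f := gaussianDensity d 1) (f' := fun z => -(gaussianDensity d 1 z * ⟪z, v⟫))
    (g := f) (g' := f') (v := v) (B := ContinuousLinearMap.mul ℝ ℝ) i4 i1 i2
    (fun x _ => hasLineDerivAt_gaussianDensity d x v) (fun x _ => h x)
  simp only [ContinuousLinearMap.mul_apply'] at this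
  rw [this, ← integral_neg]
  exact integral_congr_ae (Filter.Eventually.of_forall fun z => by simp only; ring)

theorem lipschitz_of_hasFDerivAt_inner {V : Type*} [NormedAddCommGroup V] [InnerProductSpace ℝ V]
    {h : V → ℝ} {g : V → V} {C : ℝ} (hh : ∀ x, HasFDerivAt h (innerSL ℝ (g x)) x)
    (hgC : ∀ x, ‖g x‖ ≤ C) (x y : V) : |h y - h x| ≤ C * ‖y - x‖ :=
  convex_univ.norm_image_sub_le_of_norm_hasFDerivWithin_le (𝕜 := ℝ)
    (fun x _ => (hh x).hasFDerivWithinAt)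
    (fun x _ => by rw [innerSL_apply_norm]; exact hgC x) (Set.mem_univ x) (Set.mem_univ y)

variable {h : EuclideanSpace ℝ (Fin d) → ℝ}
  {g : EuclideanSpace ℝ (Fin d) → EuclideanSpace ℝ (Fin d)} {C : ℝ}

/-- A bounded gradient forces linear growth, so the first Gaussian moment suffices. -/
theorem integrable_gaussianNoise_comp (hh : ∀ x, HasFDerivAt h (innerSL ℝ (g x)) x)
    (hgC : ∀ x, ‖g x‖ ≤ C) (τ a : ℝ) (y : EuclideanSpace ℝ (Fin d)) :
    Integrable (fun z => h (y + a • z)) (gaussianNoise d τ) := by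
  have hc : Continuous h := continuous_iff_continuousAt.2 fun x => (hh x).continuousAt
  refine ((integrable_const (|h y|)).add ((integrable_norm_gaussianNoise d τ).const_mul
    (C * |a|))).mono' (by fun_prop) (Filter.Eventually.of_forall fun z => ?_)
  have h1 := lipschitz_of_hasFDerivAt_inner hh hgC y (y + a • z)
  rw [add_sub_cancel_left, norm_smul, Real.norm_eq_abs, ← mul_assoc] at h1
  rw [Real.norm_eq_abs]
  have h2 := abs_sub_abs_le_abs_sub (h (y + a • z)) (h y)
  simp only [Pi.add_apply]
  linarith

/-- The generator of the Brownian motion with drift `y`, acting on Gaussian averages. -/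
theorem hasDerivAt_integral_gaussianNoise {κ : Type*} [Fintype κ]
    (b : OrthonormalBasis κ ℝ (EuclideanSpace ℝ (Fin d)))
    {k : κ → EuclideanSpace ℝ (Fin d) → ℝ} {K : ℝ}
    (hh : ∀ x, HasFDerivAt h (innerSL ℝ (g x)) x) (hg : Continuous g) (hgC : ∀ x, ‖g x‖ ≤ C)
    (hk : ∀ i x, HasDerivAt (fun ε : ℝ => ⟪g (x + ε • b i), b i⟫) (k i x) 0)
    (hkm : ∀ i, Measurable (k i)) (hkK : ∀ i x, |k i x| ≤ K)
    (y : EuclideanSpace ℝ (Fin d)) {s : ℝ} (hs : 0 < s) :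
    HasDerivAt (fun s => ∫ z, h (s • y + √s • z) ∂gaussianNoise d 1)
      (∫ z, (⟪g (s • y + √s • z), y⟫ + 1 / 2 * ∑ i, k i (s • y + √s • z)) ∂gaussianNoise d 1) s := by
  have hc : Continuous h := continuous_iff_continuousAt.2 fun x => (hh x).continuousAt
  have hC : 0 ≤ C := (norm_nonneg _).trans (hgC 0)
  -- On `Ioi (s / 2)` the singular factor 1/(2√s') stays bounded, which gives an integrable
  -- dominating function.
  have hd := (hasDerivAt_integral_of_dominated_loc_of_deriv_le (μ := gaussianNoise d 1)
    (F := fun s z => h (s • y + √s • z))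
    (F' := fun s z => ⟪g (s • y + √s • z), y + (1 / (2 * √s)) • z⟫)
    (bound := fun z => C * (‖y‖ + 1 / (2 * √(s / 2)) * ‖z‖))
    (s := Set.Ioi (s / 2)) (x₀ := s) (Ioi_mem_nhds (by linarith))
    (Filter.Eventually.of_forall fun s => by fun_prop)
    (integrable_gaussianNoise_comp hh hgC 1 (√s) (s • y)) (by fun_prop)
    (Filter.Eventually.of_forall fun z s' hs' => ?_)
    (((integrable_const _).add ((integrable_norm_gaussianNoise d 1).const_mul _)).const_mul _)
    (Filter.Eventually.of_forall fun z s' hs' => ?_)).2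
  · refine hd.congr_deriv ?_
    have hgm : ∀ i, Measurable fun z => ⟪g (s • y + √s • z), b i⟫ := fun i => by fun_prop
    have hb1 : ∀ i x, |⟪g x, b i⟫| ≤ C := fun i x => by
      refine (abs_real_inner_le_norm _ _).trans ?_
      rw [b.norm_eq_one, mul_one]
      exact hgC x
    -- Stein's identity in each coordinate. The √s from the inner derivative cancels the 1/√s from
    -- differentiating √s • z, leaving half the Laplacian.
    have hst : ∀ i, ∫ z, ⟪g (s • y + √s • z), b i⟫ * ⟪z, b i⟫ ∂gaussianNoise d 1 =
        ∫ z, √s * k i (s • y + √s • z) ∂gaussianNoise d 1 := fun i => by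
      refine integral_mul_inner_gaussianNoise (C := C) (K := √s * K) (hgm i) (fun x => hb1 i _)
        (((hkm i).comp (by fun_prop)).const_mul _) (fun x => ?_) (fun x => ?_)
      · rw [abs_mul, abs_of_nonneg (Real.sqrt_nonneg s)]
        exact mul_le_mul_of_nonneg_left (hkK i _) (Real.sqrt_nonneg s)
      · have h1 := hk i (s • y + √s • x)
        have h2 : HasDerivAt (fun ε : ℝ => √s * ε) (√s) 0 := by
          simpa using (hasDerivAt_id (0 : ℝ)).const_mul (√s)
        rw [show (0 : ℝ) = √s * 0 by simp] at h1
        have h3 := h1.comp (0 : ℝ) h2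
        rw [HasLineDerivAt]
        refine (h3.congr_deriv (mul_comm _ _)).congr_of_eventuallyEq
          (Filter.Eventually.of_forall fun ε => ?_)
        simp only [Function.comp, smul_add, mul_smul, add_assoc]
    have ik : ∀ i, Integrable (fun z => k i (s • y + √s • z)) (gaussianNoise d 1) := fun i =>
      Integrable.of_bound ((hkm i).comp (by fun_prop)).aestronglyMeasurable K
        (Filter.Eventually.of_forall fun z => hkK i _)
    have ig : ∀ i, Integrable (fun z => ⟪g (s • y + √s • z), b i⟫ * ⟪z, b i⟫)
        (gaussianNoise d 1) := fun i => by
      refine ((integrable_norm_gaussianNoise d 1).const_mul C).mono'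
        (by fun_prop) (Filter.Eventually.of_forall fun z => ?_)
      rw [norm_mul]
      refine mul_le_mul (hb1 i _) ((abs_real_inner_le_norm _ _).trans ?_) (norm_nonneg _) hC
      rw [b.norm_eq_one, mul_one]
    have iy : Integrable (fun z => ⟪g (s • y + √s • z), y⟫) (gaussianNoise d 1) :=
      Integrable.of_bound (by fun_prop) (C * ‖y‖) (Filter.Eventually.of_forall fun z =>
        (norm_inner_le_norm _ _).trans (mul_le_mul_of_nonneg_right (hgC _) (norm_nonneg _)))
    have hsplit : ∀ z, ⟪g (s • y + √s • z), y + (1 / (2 * √s)) • z⟫ = ⟪g (s • y + √s • z), y⟫ +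
        1 / (2 * √s) * ∑ i, ⟪g (s • y + √s • z), b i⟫ * ⟪z, b i⟫ := fun z => by
      simp_rw [real_inner_comm (b _) z]
      rw [b.sum_inner_mul_inner, inner_add_right, real_inner_smul_right]
    simp_rw [hsplit]
    rw [integral_add iy ((integrable_finsetSum _ fun i _ => ig i).const_mul _),
      integral_add iy ((integrable_finsetSum _ fun i _ => ik i).const_mul _),
      integral_const_mul, integral_const_mul, integral_finsetSum _ fun i _ => ig i,
      integral_finsetSum _ fun i _ => ik i]
    simp_rw [hst, integral_const_mul]
    rw [← Finset.mul_sum, ← mul_assoc]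
    congr 2
    have := (Real.sqrt_pos.2 hs).ne'
    field_simp
  · have hs0 : 0 < s' := by have := Set.mem_Ioi.1 hs'; linarith
    refine (norm_inner_le_norm _ _).trans (mul_le_mul (hgC _) ?_ (norm_nonneg _) hC)
    refine (norm_add_le _ _).trans ?_
    rw [norm_smul, Real.norm_of_nonneg (by positivity)]
    have : 0 < √(s / 2) := Real.sqrt_pos.2 (by linarith)
    have : √(s / 2) ≤ √s' := Real.sqrt_le_sqrt (Set.mem_Ioi.1 hs').le
    gcongr
  · have hs0 : 0 < s' := by have := Set.mem_Ioi.1 hs'; linarith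
    have hcv : HasDerivAt (fun s : ℝ => s • y + √s • z) ((1 : ℝ) • y + (1 / (2 * √s')) • z) s' :=
      ((hasDerivAt_id s').smul_const y).add ((Real.hasDerivAt_sqrt hs0.ne').smul_const z)
    rw [one_smul] at hcv
    exact (hh _).comp_hasDerivAt s' hcv

end Gaussian

end KLFisher

namespace KLFisher

local notation "⟪" x ", " y "⟫" => inner ℝ x y

/-! ### Smoothed mixtures -/

section Smoothing

variable {d : ℕ}

theorem gaussianDensity_smul {τ : ℝ} (hτ : 0 < τ) (z : EuclideanSpace ℝ (Fin d)) :
    gaussianDensity d τ (τ • z) = |(τ ^ d)⁻¹| * gaussianDensity d 1 z := by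
  have h : (2 * Real.pi * τ ^ 2) ^ (-((d : ℝ) / 2)) =
      |(τ ^ d)⁻¹| * (2 * Real.pi * 1 ^ 2) ^ (-((d : ℝ) / 2)) := by
    rw [Real.mul_rpow (by positivity) (by positivity), abs_of_pos (by positivity),
      ← Real.rpow_natCast τ 2, ← Real.rpow_mul hτ.le, ← Real.rpow_natCast τ d,
      ← Real.rpow_neg hτ.le, show ((2 : ℕ) : ℝ) * (-((d : ℝ) / 2)) = -d by push_cast; ring,
      one_pow, mul_one, mul_comm]
  simp only [gaussianDensity]
  rw [h, norm_smul, Real.norm_of_nonneg hτ.le, mul_assoc]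
  congr 3
  field_simp

/-- The change of variables x = y + τz reduces every noise level to the standard Gaussian. -/
theorem integrable_gaussianDensity_sub_mul {τ : ℝ} (hτ : 0 < τ)
    {F : EuclideanSpace ℝ (Fin d) → ℝ} {y : EuclideanSpace ℝ (Fin d)}
    (hF : Integrable (fun z => F (y + τ • z)) (gaussianNoise d 1)) :
    Integrable (fun x => gaussianDensity d τ (x - y) * F x) ∧
      ∫ x, gaussianDensity d τ (x - y) * F x = ∫ z, F (y + τ • z) ∂gaussianNoise d 1 := by
  have hd : (|(τ ^ d)⁻¹| : ℝ) ≠ 0 := by positivity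
  obtain ⟨G, hG⟩ : ∃ G : EuclideanSpace ℝ (Fin d) → ℝ,
      ∀ u, G u = gaussianDensity d τ u * F (y + u) := ⟨_, fun _ => rfl⟩
  have h1 : ∀ z, gaussianDensity d 1 z * F (y + τ • z) = |(τ ^ d)⁻¹|⁻¹ * G (τ • z) := fun z => by
    rw [hG, gaussianDensity_smul hτ]
    field_simp
  have h2 : ∀ x, gaussianDensity d τ (x - y) * F x = G (x - y) := fun x => by simp [hG]
  constructor
  · rw [integrable_gaussianNoise_iff one_pos] at hF
    simp_rw [h1] at hF
    rw [integrable_const_mul_iff (IsUnit.mk0 _ (inv_ne_zero hd)),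
      integrable_comp_smul_iff volume _ hτ.ne'] at hF
    simp_rw [h2]
    exact hF.comp_sub_right y
  · rw [integral_gaussianNoise one_pos]
    simp_rw [h1, h2]
    rw [integral_const_mul, Measure.integral_comp_smul, integral_sub_right_eq_self G, finrank_euclideanSpace_fin, smul_eq_mul,
      ← mul_assoc, inv_mul_cancel₀ hd, one_mul]

end Smoothing

namespace SphereMixture

variable {d : ℕ} {ι : Type*} [Fintype ι] (P : SphereMixture (EuclideanSpace ℝ (Fin d)) ι)

/-- `ν` is the law of the mixture `P`. -/
def IsLaw (ν : Measure (EuclideanSpace ℝ (Fin d))) : Prop :=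
  ∀ f : EuclideanSpace ℝ (Fin d) → ℝ, ∫ y, f y ∂ν = ∑ i, P.w i * f (P.Y i)

variable {P} {ν : Measure (EuclideanSpace ℝ (Fin d))}

theorem IsLaw.density_eq_sum (hν : P.IsLaw ν) (τ : ℝ) (x : EuclideanSpace ℝ (Fin d)) :
    density ν τ x = ∑ i, P.w i * gaussianDensity d τ (x - P.Y i) := hν _

/-- Expand the square: since ‖Y i‖ = r, only the inner product still depends on the atom. -/
theorem gaussianDensity_sub (i : ι) {τ : ℝ} (hτ : 0 < τ) (x : EuclideanSpace ℝ (Fin d)) :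
    gaussianDensity d τ (x - P.Y i) = gaussianDensity d τ x *
      Real.exp (-(P.r ^ 2 / (2 * τ ^ 2))) * Real.exp ⟪P.Y i, (τ ^ 2)⁻¹ • x⟫ := by
  rw [gaussianDensity, gaussianDensity, mul_assoc ((2 * Real.pi * τ ^ 2) ^ (-((d : ℝ) / 2))),
    mul_assoc ((2 * Real.pi * τ ^ 2) ^ (-((d : ℝ) / 2))), ← Real.exp_add, ← Real.exp_add, norm_sub_sq_real, P.norm_Y, real_inner_smul_right, real_inner_comm]
  congr 2
  field_simp
  ring

theorem IsLaw.density_eq (hν : P.IsLaw ν) {τ : ℝ} (hτ : 0 < τ) (x : EuclideanSpace ℝ (Fin d)) :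
    density ν τ x = gaussianDensity d τ x *
      Real.exp (-(P.r ^ 2 / (2 * τ ^ 2))) * P.laplace ((τ ^ 2)⁻¹ • x) := by
  rw [hν.density_eq_sum, laplace, Finset.mul_sum]
  refine Finset.sum_congr rfl fun i _ => ?_
  rw [gaussianDensity_sub i hτ]
  ring

theorem IsLaw.density_pos (hν : P.IsLaw ν) {τ : ℝ} (hτ : 0 < τ) (x : EuclideanSpace ℝ (Fin d)) :
    0 < density ν τ x := by
  rw [hν.density_eq hτ]
  exact mul_pos (mul_pos (gaussianDensity_pos d hτ x) (Real.exp_pos _)) (P.laplace_pos _)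

theorem IsLaw.continuous_density (hν : P.IsLaw ν) (τ : ℝ) : Continuous (density ν τ) := by
  rw [funext (hν.density_eq_sum τ)]
  fun_prop

/-- Bayes' rule: both sides are the joint density of the atom and the observation. -/
theorem IsLaw.density_mul_post (hν : P.IsLaw ν) {τ : ℝ} (hτ : 0 < τ)
    (x : EuclideanSpace ℝ (Fin d)) (i : ι) :
    density ν τ x * P.post ((τ ^ 2)⁻¹ • x) i = P.w i * gaussianDensity d τ (x - P.Y i) := by
  rw [hν.density_eq hτ, gaussianDensity_sub i hτ, post]
  have := (P.laplace_pos ((τ ^ 2)⁻¹ • x)).ne'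
  generalize (τ ^ 2)⁻¹ • x = z at *
  field_simp

theorem IsLaw.density_div (hν : P.IsLaw ν) {κ : Type*} [Fintype κ]
    {Q : SphereMixture (EuclideanSpace ℝ (Fin d)) κ} {μ : Measure (EuclideanSpace ℝ (Fin d))}
    (hμ : Q.IsLaw μ) (hr : P.r = Q.r) {τ : ℝ} (hτ : 0 < τ) (x : EuclideanSpace ℝ (Fin d)) :
    density ν τ x / density μ τ x =
      P.laplace ((τ ^ 2)⁻¹ • x) / Q.laplace ((τ ^ 2)⁻¹ • x) := by
  rw [hν.density_eq hτ, hμ.density_eq hτ, hr, mul_div_mul_left]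
  exact mul_ne_zero (gaussianDensity_pos d hτ x).ne' (Real.exp_pos _).ne'

theorem hasFDerivAt_comp_smul {V W : Type*} [NormedAddCommGroup V] [NormedSpace ℝ V]
    [NormedAddCommGroup W] [NormedSpace ℝ W] {f : V → W} {f' : V →L[ℝ] W} {c : ℝ} {x : V}
    (hf : HasFDerivAt f f' (c • x)) : HasFDerivAt (fun z => f (c • z)) (c • f') x := by
  have := hf.comp x ((hasFDerivAt_id x).const_smul c)
  refine this.congr_fderiv ?_
  ext v
  simp

theorem hasGradientAt_of_innerSL {V : Type*} [NormedAddCommGroup V] [InnerProductSpace ℝ V]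
    [CompleteSpace V] {f : V → ℝ} {g x : V} (h : HasFDerivAt f (innerSL ℝ g) x) :
    HasGradientAt f g x := by
  rw [hasGradientAt_iff_hasFDerivAt]
  exact h

/-- Tweedie's formula: the score is the posterior mean minus the observation, rescaled. -/
theorem IsLaw.score_eq (hν : P.IsLaw ν) {τ : ℝ} (hτ : 0 < τ) (x : EuclideanSpace ℝ (Fin d)) :
    score ν τ x = (τ ^ 2)⁻¹ • (P.mean ((τ ^ 2)⁻¹ • x) - x) := by
  have hlog : ∀ z, Real.log (density ν τ z) =
      (Real.log ((2 * Real.pi * τ ^ 2) ^ (-((d : ℝ) / 2))) - P.r ^ 2 / (2 * τ ^ 2)) +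
        (-(2 * τ ^ 2)⁻¹) * ‖z‖ ^ 2 + Real.log (P.laplace ((τ ^ 2)⁻¹ • z)) := fun z => by
    rw [hν.density_eq hτ, gaussianDensity, Real.log_mul (by positivity) (P.laplace_pos _).ne',
      Real.log_mul (by positivity) (by positivity), Real.log_mul (by positivity) (by positivity),
      Real.log_exp, Real.log_exp]
    ring
  refine (hasGradientAt_of_innerSL ?_).gradient
  simp_rw [hlog]
  have h1 : HasFDerivAt (fun x : EuclideanSpace ℝ (Fin d) => ‖x‖ ^ 2) (2 • innerSL ℝ x) x :=
    (hasStrictFDerivAt_norm_sq x).hasFDerivAt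
  refine (((h1.const_mul _).const_add _).add
    (hasFDerivAt_comp_smul (P.hasFDerivAt_log_laplace _))).congr_fderiv ?_
  ext v
  simp only [smul_apply, add_apply, innerSL_apply_apply, smul_eq_mul, nsmul_eq_mul,
    real_inner_smul_left, inner_sub_left]
  push_cast
  field_simp
  ring

theorem IsLaw.hasFDerivAt_score (hν : P.IsLaw ν) {τ : ℝ} (hτ : 0 < τ)
    (x : EuclideanSpace ℝ (Fin d)) :
    HasFDerivAt (score ν τ) ((τ ^ 2)⁻¹ • ((τ ^ 2)⁻¹ • P.cov ((τ ^ 2)⁻¹ • x) -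
      ContinuousLinearMap.id ℝ _)) x := by
  rw [funext (hν.score_eq hτ)]
  exact ((hasFDerivAt_comp_smul (P.hasFDerivAt_mean _)).sub (hasFDerivAt_id x)).const_smul
    ((τ ^ 2)⁻¹)

/-! ### Averages along the heat flow -/

/-- The tower property. `F` may depend on the atom because the drift of the heat flow in the
variable x/t is the hidden atom itself. -/
theorem IsLaw.integrable_sum (hν : P.IsLaw ν) {τ : ℝ} (hτ : 0 < τ)
    {F : ι → EuclideanSpace ℝ (Fin d) → ℝ}
    (hF : ∀ i, Integrable (fun z => F i (P.Y i + τ • z)) (gaussianNoise d 1)) :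
    Integrable (fun x => density ν τ x * ∑ i, P.post ((τ ^ 2)⁻¹ • x) i * F i x) ∧
      ∫ x, density ν τ x * ∑ i, P.post ((τ ^ 2)⁻¹ • x) i * F i x =
        ∑ i, P.w i * ∫ z, F i (P.Y i + τ • z) ∂gaussianNoise d 1 := by
  have h : ∀ x, density ν τ x * ∑ i, P.post ((τ ^ 2)⁻¹ • x) i * F i x =
      ∑ i, P.w i * (gaussianDensity d τ (x - P.Y i) * F i x) := fun x => by
    rw [Finset.mul_sum]
    refine Finset.sum_congr rfl fun i _ => ?_
    rw [← mul_assoc, hν.density_mul_post hτ, mul_assoc]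
  have hi := fun i => integrable_gaussianDensity_sub_mul hτ (hF i)
  simp_rw [h]
  refine ⟨integrable_finsetSum _ fun i _ => (hi i).1.const_mul _, ?_⟩
  rw [integral_finsetSum _ fun i _ => (hi i).1.const_mul _]
  refine Finset.sum_congr rfl fun i _ => ?_
  rw [integral_const_mul, (hi i).2]

theorem IsLaw.integrable_density_mul (hν : P.IsLaw ν) {τ : ℝ} (hτ : 0 < τ)
    {F : EuclideanSpace ℝ (Fin d) → ℝ}
    (hF : ∀ i, Integrable (fun z => F (P.Y i + τ • z)) (gaussianNoise d 1)) :
    Integrable (fun x => density ν τ x * F x) ∧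
      ∫ x, density ν τ x * F x = ∑ i, P.w i * ∫ z, F (P.Y i + τ • z) ∂gaussianNoise d 1 := by
  have := hν.integrable_sum hτ (F := fun _ => F) hF
  simp_rw [← Finset.sum_mul, P.sum_post, one_mul] at this
  exact this

variable {h : EuclideanSpace ℝ (Fin d) → ℝ}
  {g : EuclideanSpace ℝ (Fin d) → EuclideanSpace ℝ (Fin d)} {C : ℝ}

/-- Time inversion: heat flow at time t, divided by t, becomes Brownian motion with drift y at time
1/t. -/
theorem sqrt_inv_smul {t : ℝ} (ht : 0 < t) (y z : EuclideanSpace ℝ (Fin d)) :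
    t⁻¹ • (y + √t • z) = t⁻¹ • y + √t⁻¹ • z := by
  rw [smul_add, smul_smul]
  congr 2
  have h1 := (Real.sqrt_pos.2 ht).ne'
  rw [Real.sqrt_inv]
  nth_rw 1 [← Real.sq_sqrt ht.le]
  field_simp

theorem IsLaw.integrable_average (hν : P.IsLaw ν) (hh : ∀ x, HasFDerivAt h (innerSL ℝ (g x)) x)
    (hgC : ∀ x, ‖g x‖ ≤ C) {t : ℝ} (ht : 0 < t) :
    Integrable (fun x => density ν (√t) x * h (t⁻¹ • x)) ∧
      ∫ x, density ν (√t) x * h (t⁻¹ • x) =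
        ∑ i, P.w i * ∫ z, h (t⁻¹ • P.Y i + √t⁻¹ • z) ∂gaussianNoise d 1 := by
  simp_rw [← sqrt_inv_smul ht]
  refine hν.integrable_density_mul (Real.sqrt_pos.2 ht) (F := fun x => h (t⁻¹ • x)) fun i => ?_
  simp_rw [sqrt_inv_smul ht]
  exact integrable_gaussianNoise_comp hh hgC _ _ _

/-- The generator of the heat flow of a mixture, acting on averages in the rescaled variable. -/
theorem IsLaw.hasDerivAt_average (hν : P.IsLaw ν) {κ : Type*} [Fintype κ]
    (b : OrthonormalBasis κ ℝ (EuclideanSpace ℝ (Fin d)))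
    {k : κ → EuclideanSpace ℝ (Fin d) → ℝ} {K : ℝ}
    (hh : ∀ x, HasFDerivAt h (innerSL ℝ (g x)) x) (hg : Continuous g) (hgC : ∀ x, ‖g x‖ ≤ C)
    (hk : ∀ i x, HasDerivAt (fun ε : ℝ => ⟪g (x + ε • b i), b i⟫) (k i x) 0)
    (hkm : ∀ i, Measurable (k i)) (hkK : ∀ i x, |k i x| ≤ K) {t : ℝ} (ht : 0 < t) :
    Integrable (fun x => density ν (√t) x *
        (⟪g (t⁻¹ • x), P.mean (t⁻¹ • x)⟫ + 1 / 2 * ∑ i, k i (t⁻¹ • x))) ∧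
      HasDerivAt (fun t => ∫ x, density ν (√t) x * h (t⁻¹ • x))
        (-(t ^ 2)⁻¹ * ∫ x, density ν (√t) x *
          (⟪g (t⁻¹ • x), P.mean (t⁻¹ • x)⟫ + 1 / 2 * ∑ i, k i (t⁻¹ • x))) t := by
  have hs := hν.integrable_sum (Real.sqrt_pos.2 ht)
    (F := fun i x => ⟪g (t⁻¹ • x), P.Y i⟫ + 1 / 2 * ∑ j, k j (t⁻¹ • x)) fun i => by
      refine Integrable.add ?_ ((integrable_finsetSum _ fun j _ => ?_).const_mul _)
      · exact Integrable.of_bound (by fun_prop) (C * ‖P.Y i‖) (Filter.Eventually.of_forall fun z =>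
          (norm_inner_le_norm _ _).trans (mul_le_mul_of_nonneg_right (hgC _) (norm_nonneg _)))
      · exact Integrable.of_bound ((hkm j).comp (by fun_prop)).aestronglyMeasurable K
          (Filter.Eventually.of_forall fun z => hkK j _)
  -- Conditioning on the observation replaces the drift `Y i` by the posterior mean.
  have hsum : ∀ x, ∑ i, P.post (t⁻¹ • x) i *
      (⟪g (t⁻¹ • x), P.Y i⟫ + 1 / 2 * ∑ j, k j (t⁻¹ • x)) =
      ⟪g (t⁻¹ • x), P.mean (t⁻¹ • x)⟫ + 1 / 2 * ∑ j, k j (t⁻¹ • x) := fun x => by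
    simp_rw [mul_add]
    rw [Finset.sum_add_distrib, ← Finset.sum_mul, P.sum_post, one_mul, mean, inner_sum]
    simp_rw [real_inner_smul_right]
  simp_rw [Real.sq_sqrt ht.le, hsum, sqrt_inv_smul ht] at hs
  refine ⟨hs.1, ?_⟩
  rw [hs.2]
  have hinv : HasDerivAt (fun t : ℝ => t⁻¹) (-(t ^ 2)⁻¹) t := hasDerivAt_inv ht.ne'
  have hd := HasDerivAt.fun_sum (u := Finset.univ) fun i _ =>
    ((hasDerivAt_integral_gaussianNoise b hh hg hgC hk hkm hkK (P.Y i)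
      (inv_pos.2 ht)).comp t hinv).const_mul (P.w i)
  refine (hd.congr_deriv ?_).congr_of_eventuallyEq ?_
  · rw [Finset.mul_sum]
    exact Finset.sum_congr rfl fun i _ => by ring
  · filter_upwards [Ioi_mem_nhds ht] with u hu
    exact (hν.integrable_average hh hgC hu).2

end SphereMixture

end KLFisher

namespace KLFisher

local notation "⟪" x ", " y "⟫" => inner ℝ x y

namespace SphereMixture

/-! ### Pairs of mixtures -/

section Pair

variable {V : Type*} [NormedAddCommGroup V] [InnerProductSpace ℝ V] {ι κ : Type*} [Fintype ι]
  [Fintype κ] (P : SphereMixture V ι) (Q : SphereMixture V κ)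

/-- The difference of the tilted means. -/
noncomputable def meanDiff (z : V) : V := P.mean z - Q.mean z

/-- The difference of the tilted covariances. -/
noncomputable def covDiff (z : V) : V →L[ℝ] V := P.cov z - Q.cov z

/-- The difference of the logarithms of the Laplace transforms. -/
noncomputable def logRatio (z : V) : ℝ := Real.log (P.laplace z) - Real.log (Q.laplace z)

theorem hasFDerivAt_logRatio (z : V) :
    HasFDerivAt (P.logRatio Q) (innerSL ℝ (P.meanDiff Q z)) z := by
  rw [meanDiff, map_sub]
  exact (P.hasFDerivAt_log_laplace z).sub (Q.hasFDerivAt_log_laplace z)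

theorem hasFDerivAt_meanDiff (z : V) : HasFDerivAt (P.meanDiff Q) (P.covDiff Q z) z :=
  (P.hasFDerivAt_mean z).sub (Q.hasFDerivAt_mean z)

@[fun_prop]
theorem continuous_meanDiff : Continuous (P.meanDiff Q) :=
  P.continuous_mean.sub Q.continuous_mean

theorem continuous_covDiff_apply {f : V → V} (hf : Continuous f) :
    Continuous fun z => P.covDiff Q z (f z) :=
  (P.continuous_cov_apply hf).sub (Q.continuous_cov_apply hf)

theorem inner_covDiff_comm (z u v : V) : ⟪P.covDiff Q z u, v⟫ = ⟪P.covDiff Q z v, u⟫ := by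
  simp only [covDiff, sub_apply, inner_sub_left]
  rw [P.inner_cov_comm z u v, Q.inner_cov_comm z u v]

variable {P Q}

theorem norm_meanDiff_le (hr : P.r = Q.r) (z : V) : ‖P.meanDiff Q z‖ ≤ 2 * Q.r := by
  have h1 := P.norm_mean_le z
  have h2 := Q.norm_mean_le z
  have h3 := norm_sub_le (P.mean z) (Q.mean z)
  rw [meanDiff]
  linarith

theorem norm_covDiff_apply_le (hr : P.r = Q.r) (z v : V) :
    ‖P.covDiff Q z v‖ ≤ 4 * Q.r ^ 2 * ‖v‖ := by
  have h1 := P.norm_cov_apply_le z v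
  have h2 := Q.norm_cov_apply_le z v
  have h3 := norm_sub_le (P.cov z v) (Q.cov z v)
  rw [covDiff, sub_apply]
  rw [hr] at h1
  linarith

theorem hasFDerivAt_norm_sq_meanDiff (z : V) :
    HasFDerivAt (fun z => ‖P.meanDiff Q z‖ ^ 2)
      (innerSL ℝ ((2 : ℝ) • P.covDiff Q z (P.meanDiff Q z))) z := by
  refine (P.hasFDerivAt_meanDiff Q z).norm_sq.congr_fderiv ?_
  ext v
  simp only [innerSL_apply_apply, real_inner_smul_left, smul_apply, ContinuousLinearMap.comp_apply]
  rw [inner_covDiff_comm, real_inner_comm, nsmul_eq_mul]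
  norm_num

variable (P) in
/-- The derivative of `z ↦ P.cov z (f z)` in the direction `u`, with `f'` that of `f`. -/
noncomputable def covDeriv (z u f f' : V) : V :=
  P.third z u f + P.cov z f' - ⟪P.cov z u, f⟫ • P.mean z

/-- The three terms of `covDeriv` contribute 8, 8 and 4. The assumed sizes of `f` and `f'` are those
of `meanDiff` and of `covDiff` on unit vectors. -/
theorem norm_covDeriv_le {z u f f' : V} (hu : ‖u‖ = 1) (hf : ‖f‖ ≤ 2 * P.r)
    (hf' : ‖f'‖ ≤ 4 * P.r ^ 2) : ‖P.covDeriv z u f f'‖ ≤ 20 * P.r ^ 4 := by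
  have hr := P.r_nonneg
  have h1 : ‖P.third z u f‖ ≤ 4 * P.r ^ 3 * (1 * (2 * P.r)) :=
    (P.norm_third_le z u f).trans (by rw [hu]; gcongr)
  have h2 : ‖P.cov z f'‖ ≤ 2 * P.r ^ 2 * (4 * P.r ^ 2) :=
    (P.norm_cov_apply_le z f').trans (by gcongr)
  have h3 : ‖⟪P.cov z u, f⟫ • P.mean z‖ ≤ (2 * P.r ^ 2 * 1) * (2 * P.r) * P.r := by
    rw [norm_smul]
    have h4 := P.norm_cov_apply_le z u
    rw [hu] at h4
    refine mul_le_mul ((norm_inner_le_norm _ _).trans ?_) (P.norm_mean_le z) (norm_nonneg _)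
      (by positivity)
    gcongr
  calc _ ≤ ‖P.third z u f‖ + ‖P.cov z f'‖ + ‖⟪P.cov z u, f⟫ • P.mean z‖ :=
        (norm_sub_le _ _).trans (add_le_add_left (norm_add_le _ _) _)
    _ ≤ _ := by linarith

/-- The third-order term and the moving centre each contribute -⟨Σf, m⟩, hence the factor 2. -/
theorem sum_inner_covDeriv {σ : Type*} [Fintype σ] (b : OrthonormalBasis σ ℝ V) (z f : V)
    (H : V →L[ℝ] V) :
    ∑ k, ⟪P.covDeriv z (b k) f (H (b k)), b k⟫ =
      ∑ k, ⟪P.cov z (H (b k)), b k⟫ - 2 * ⟪P.cov z f, P.mean z⟫ := by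
  have h : ∑ k, ⟪P.cov z (b k), f⟫ * ⟪P.mean z, b k⟫ = ⟪P.cov z f, P.mean z⟫ := by
    simp_rw [P.inner_cov_comm z (b _) f, real_inner_comm (b _) (P.mean z)]
    exact b.sum_inner_mul_inner _ _
  simp_rw [covDeriv, inner_sub_left, inner_add_left, real_inner_smul_left]
  rw [Finset.sum_sub_distrib, Finset.sum_add_distrib, sum_inner_third, h]
  ring

theorem continuous_covDeriv {u : V} {f f' : V → V} (hf : Continuous f) (hf' : Continuous f') :
    Continuous fun z => P.covDeriv z u (f z) (f' z) := by
  unfold covDeriv third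
  have h1 := P.continuous_cov_apply hf'
  have h2 := P.continuous_cov_apply (continuous_const (y := u))
  fun_prop

end Pair

variable {d : ℕ} {ι κ : Type*} [Fintype ι] [Fintype κ]
  {P : SphereMixture (EuclideanSpace ℝ (Fin d)) ι} {Q : SphereMixture (EuclideanSpace ℝ (Fin d)) κ}
  {μ ν : Measure (EuclideanSpace ℝ (Fin d))}

theorem IsLaw.log_density_div (hμ : P.IsLaw μ) (hν : Q.IsLaw ν) (hr : P.r = Q.r) {τ : ℝ}
    (hτ : 0 < τ) (x : EuclideanSpace ℝ (Fin d)) :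
    Real.log (density μ τ x / density ν τ x) = P.logRatio Q ((τ ^ 2)⁻¹ • x) := by
  rw [hμ.density_div hν hr hτ, Real.log_div (P.laplace_pos _).ne' (Q.laplace_pos _).ne', logRatio]

theorem IsLaw.fisherIntegrand_eq (hμ : P.IsLaw μ) (hν : Q.IsLaw ν) (hr : P.r = Q.r) {t : ℝ}
    (ht : 0 < t) (x : EuclideanSpace ℝ (Fin d)) :
    fisherIntegrand μ ν t x =
      (t ^ 2)⁻¹ * (density μ (√t) x * ‖P.meanDiff Q (t⁻¹ • x)‖ ^ 2) := by
  rw [fisherIntegrand, funext (hμ.log_density_div hν hr (Real.sqrt_pos.2 ht)),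
    Real.sq_sqrt ht.le]
  have h : HasFDerivAt (fun z => P.logRatio Q (t⁻¹ • z))
      (innerSL ℝ (t⁻¹ • P.meanDiff Q (t⁻¹ • x))) x := by
    rw [map_smul]
    exact hasFDerivAt_comp_smul (P.hasFDerivAt_logRatio Q _)
  rw [(hasGradientAt_of_innerSL h).gradient, norm_smul, mul_pow, Real.norm_eq_abs, sq_abs]
  ring

theorem IsLaw.score_sub_score (hμ : P.IsLaw μ) (hν : Q.IsLaw ν) {τ : ℝ} (hτ : 0 < τ)
    (x : EuclideanSpace ℝ (Fin d)) :
    score μ τ x - score ν τ x = (τ ^ 2)⁻¹ • P.meanDiff Q ((τ ^ 2)⁻¹ • x) := by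
  rw [hμ.score_eq hτ, hν.score_eq hτ, ← smul_sub, meanDiff]
  congr 1
  abel

theorem IsLaw.integrable_smoothed_iff [IsProbabilityMeasure μ] (hμ : P.IsLaw μ) {τ : ℝ}
    (hτ : 0 < τ) (F : EuclideanSpace ℝ (Fin d) → ℝ) :
    (Integrable F (smoothed μ τ) ↔ Integrable fun x => density μ τ x * F x) ∧
      ∫ x, F x ∂(smoothed μ τ) = ∫ x, density μ τ x * F x := by
  have hm : Measurable fun x => ENNReal.ofReal (density μ τ x) :=
    (hμ.continuous_density τ).measurable.ennreal_ofReal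
  rw [smoothed_eq_withDensity μ hτ, integrable_withDensity_iff_integrable_smul' hm (by simp),
    integral_withDensity_eq_integral_toReal_smul hm (by simp)]
  simp_rw [ENNReal.toReal_ofReal (hμ.density_pos hτ _).le, smul_eq_mul]
  simp

instance isProbabilityMeasure_smoothed [IsProbabilityMeasure μ] (τ : ℝ) :
    IsProbabilityMeasure (smoothed μ τ) := by
  unfold smoothed
  infer_instance

/-! ### Finiteness of the divergence and its integral formula -/

section KL

variable [IsProbabilityMeasure μ] [IsProbabilityMeasure ν]

theorem IsLaw.smoothed_eq_withDensity_div (hμ : P.IsLaw μ) (hν : Q.IsLaw ν) {τ : ℝ}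
    (hτ : 0 < τ) : smoothed μ τ =
      (smoothed ν τ).withDensity fun x => ENNReal.ofReal (density μ τ x / density ν τ x) := by
  have h1 := (hμ.continuous_density τ).measurable
  have h2 := (hν.continuous_density τ).measurable
  have h3 : Measurable fun x => ENNReal.ofReal (density μ τ x / density ν τ x) :=
    (h1.div h2).ennreal_ofReal
  rw [smoothed_eq_withDensity μ hτ, smoothed_eq_withDensity ν hτ,
    ← withDensity_mul _ h2.ennreal_ofReal h3]
  congr 1
  ext x
  rw [Pi.mul_apply, ← ENNReal.ofReal_mul (hν.density_pos hτ x).le,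
    mul_div_cancel₀ _ (hν.density_pos hτ x).ne']

theorem IsLaw.llr_smoothed (hμ : P.IsLaw μ) (hν : Q.IsLaw ν) (hr : P.r = Q.r) {τ : ℝ}
    (hτ : 0 < τ) : smoothed μ τ ≪ smoothed ν τ ∧
      llr (smoothed μ τ) (smoothed ν τ) =ᵐ[smoothed μ τ]
        fun x => P.logRatio Q ((τ ^ 2)⁻¹ • x) := by
  have h1 := (hμ.continuous_density τ).measurable
  have h2 := (hν.continuous_density τ).measurable
  have hac : smoothed μ τ ≪ smoothed ν τ := by
    rw [hμ.smoothed_eq_withDensity_div hν hτ]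
    exact withDensity_absolutelyContinuous _ _
  refine ⟨hac, hac.ae_le ?_⟩
  have := Measure.rnDeriv_withDensity (smoothed ν τ) (h1.div h2).ennreal_ofReal
  rw [Pi.div_def, ← hμ.smoothed_eq_withDensity_div hν hτ] at this
  filter_upwards [this] with x hx
  rw [llr, hx, ENNReal.toReal_ofReal (div_pos (hμ.density_pos hτ x) (hν.density_pos hτ x)).le,
    hμ.log_density_div hν hr hτ]

theorem IsLaw.klDiv_ne_top (hμ : P.IsLaw μ) (hν : Q.IsLaw ν) (hr : P.r = Q.r) {t : ℝ}
    (ht : 0 < t) :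
    InformationTheory.klDiv (smoothed μ (√t)) (smoothed ν (√t)) ≠ ⊤ ∧
      klFlow μ ν t = ∫ x, density μ (√t) x * P.logRatio Q (t⁻¹ • x) := by
  have hτ := Real.sqrt_pos.2 ht
  obtain ⟨hac, hl⟩ := hμ.llr_smoothed hν hr hτ
  have hi := (hμ.integrable_average (P.hasFDerivAt_logRatio Q) (norm_meanDiff_le hr) ht).1
  rw [Real.sq_sqrt ht.le] at hl
  have h := hμ.integrable_smoothed_iff hτ fun x => P.logRatio Q (t⁻¹ • x)
  refine ⟨InformationTheory.klDiv_ne_top hac ((h.1.2 hi).congr hl.symm), ?_⟩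
  -- Both laws have mass one, so the mass correction in `klDiv` vanishes.
  rw [klFlow, InformationTheory.toReal_klDiv_of_measure_eq hac (by simp), integral_congr_ae hl, h.2]

end KL

theorem IsLaw.integrable_norm_sq_meanDiff (hμ : P.IsLaw μ) (hr : P.r = Q.r) {t : ℝ} (ht : 0 < t) :
    Integrable (fun x => density μ (√t) x * ‖P.meanDiff Q (t⁻¹ • x)‖ ^ 2) := by
  refine (hμ.integrable_average (C := 2 * (4 * Q.r ^ 2 * (2 * Q.r)))
    hasFDerivAt_norm_sq_meanDiff (fun x => ?_) ht).1
  rw [norm_smul, Real.norm_of_nonneg two_pos.le]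
  have := norm_meanDiff_le hr x
  gcongr
  exact (norm_covDiff_apply_le hr x (P.meanDiff Q x)).trans (by gcongr)

theorem IsLaw.integrable_fisherIntegrand (hμ : P.IsLaw μ) (hν : Q.IsLaw ν) (hr : P.r = Q.r)
    {t : ℝ} (ht : 0 < t) : Integrable (fisherIntegrand μ ν t) := by
  rw [funext (hμ.fisherIntegrand_eq hν hr ht)]
  exact (hμ.integrable_norm_sq_meanDiff hr ht).const_mul _

theorem IsLaw.fisherFlow_eq (hμ : P.IsLaw μ) (hν : Q.IsLaw ν) (hr : P.r = Q.r) {t : ℝ}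
    (ht : 0 < t) : fisherFlow μ ν t =
      (t ^ 2)⁻¹ * ∫ x, density μ (√t) x * ‖P.meanDiff Q (t⁻¹ • x)‖ ^ 2 := by
  rw [fisherFlow, funext (hμ.fisherIntegrand_eq hν hr ht), integral_const_mul]

theorem hasDerivAt_add_smul {V : Type*} [NormedAddCommGroup V] [NormedSpace ℝ V] (x v : V) :
    HasDerivAt (fun ε : ℝ => x + ε • v) v 0 := by
  simpa using ((hasDerivAt_id (0 : ℝ)).smul_const v).const_add x

/-- The de Bruijn identity. -/
theorem IsLaw.hasDerivAt_klFlow [IsProbabilityMeasure μ] [IsProbabilityMeasure ν]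
    (hμ : P.IsLaw μ) (hν : Q.IsLaw ν) (hr : P.r = Q.r) {t : ℝ} (ht : 0 < t) :
    HasDerivAt (klFlow μ ν) (-(1 / 2) * fisherFlow μ ν t) t := by
  have hb := fun i => (EuclideanSpace.basisFun (Fin d) ℝ).norm_eq_one i
  have h := (hμ.hasDerivAt_average (EuclideanSpace.basisFun (Fin d) ℝ)
    (k := fun i x => ⟪P.covDiff Q x (EuclideanSpace.basisFun (Fin d) ℝ i),
      EuclideanSpace.basisFun (Fin d) ℝ i⟫) (K := 4 * Q.r ^ 2 * 1 * 1)
    (P.hasFDerivAt_logRatio Q) (P.continuous_meanDiff Q) (norm_meanDiff_le hr)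
    (fun i x => ?_) (fun i => ?_) (fun i x => ?_) ht).2
  · refine (h.congr_of_eventuallyEq ?_).congr_deriv ?_
    · filter_upwards [Ioi_mem_nhds ht] with u hu
      exact (hμ.klDiv_ne_top hν hr hu).2
    · rw [hμ.fisherFlow_eq hν hr ht]
      -- By the trace formula, ⟨m_P - m_Q, m_P⟩ + ½(|m_Q|² - |m_P|²) completes to a square.
      have hp : ∀ x, ⟪P.meanDiff Q x, P.mean x⟫ + 1 / 2 * ∑ i, ⟪P.covDiff Q x
          (EuclideanSpace.basisFun (Fin d) ℝ i), EuclideanSpace.basisFun (Fin d) ℝ i⟫ =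
          1 / 2 * ‖P.meanDiff Q x‖ ^ 2 := fun x => by
        simp only [covDiff, sub_apply, inner_sub_left]
        rw [Finset.sum_sub_distrib, sum_inner_cov, sum_inner_cov, meanDiff, hr, norm_sub_sq_real,
          inner_sub_left, real_inner_self_eq_norm_sq, real_inner_comm]
        ring
      simp_rw [hp, mul_left_comm _ (1 / 2 : ℝ)]
      rw [integral_const_mul]
      ring
  · have h1 := (P.hasFDerivAt_meanDiff Q (x + (0 : ℝ) • _)).comp_hasDerivAt (0 : ℝ)
      (hasDerivAt_add_smul x (EuclideanSpace.basisFun (Fin d) ℝ i))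
    rw [zero_smul, add_zero] at h1
    simpa using h1.inner ℝ (hasDerivAt_const (0 : ℝ) (EuclideanSpace.basisFun (Fin d) ℝ i))
  · exact ((P.continuous_covDiff_apply Q continuous_const).inner continuous_const).measurable
  · refine (abs_real_inner_le_norm _ _).trans ?_
    have := norm_covDiff_apply_le hr x (EuclideanSpace.basisFun (Fin d) ℝ i)
    rw [hb] at this ⊢
    linarith

/-- The derivative of the relative Fisher information is controlled by the curvature of the
reference law. -/
theorem IsLaw.hasDerivAt_fisherFlow (hμ : P.IsLaw μ) (hν : Q.IsLaw ν) (hr : P.r = Q.r) {Λ : ℝ}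
    (hΛ : ∀ z v, ⟪Q.cov z v, v⟫ ≤ Λ * ‖v‖ ^ 2) {t : ℝ} (ht : 0 < t) :
    ∃ J' : ℝ, HasDerivAt (fisherFlow μ ν) J' t ∧
      J' ≤ 2 * (Λ / t ^ 2 - 1 / t) * fisherFlow μ ν t := by
  obtain ⟨b, hbb⟩ : ∃ b, b = EuclideanSpace.basisFun (Fin d) ℝ := ⟨_, rfl⟩
  have hb := fun i => b.norm_eq_one i
  have hQ := Q.r_nonneg
  have hD := fun x => norm_meanDiff_le hr x
  have hH := fun x i => norm_covDiff_apply_le hr x (b i)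
  have h := hμ.hasDerivAt_average (C := 2 * (4 * Q.r ^ 2 * (2 * Q.r))) b
    (g := fun x => (2 : ℝ) • P.covDiff Q x (P.meanDiff Q x))
    (k := fun i x => 2 * (⟪P.covDeriv x (b i) (P.meanDiff Q x) (P.covDiff Q x (b i)), b i⟫ -
      ⟪Q.covDeriv x (b i) (P.meanDiff Q x) (P.covDiff Q x (b i)), b i⟫))
    (K := 2 * (20 * Q.r ^ 4 + 20 * Q.r ^ 4)) hasFDerivAt_norm_sq_meanDiff
    ((P.continuous_covDiff_apply Q (P.continuous_meanDiff Q)).const_smul (2 : ℝ))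
    (fun x => ?_) (fun i x => ?_) (fun i => ?_) (fun i x => ?_) ht
  · obtain ⟨hint, hder⟩ := h
    -- A Bochner-type identity: the traces combine to ‖H‖²_HS, and of the first-order terms only
    -- -2⟨Σ_Q δ, δ⟩ survives; every term with Σ_P δ cancels.
    have hp : ∀ x, ⟪(2 : ℝ) • P.covDiff Q x (P.meanDiff Q x), P.mean x⟫ +
        1 / 2 * ∑ i, 2 * (⟪P.covDeriv x (b i) (P.meanDiff Q x) (P.covDiff Q x (b i)), b i⟫ -
          ⟪Q.covDeriv x (b i) (P.meanDiff Q x) (P.covDiff Q x (b i)), b i⟫) =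
        ∑ i, ‖P.covDiff Q x (b i)‖ ^ 2 - 2 * ⟪Q.cov x (P.meanDiff Q x), P.meanDiff Q x⟫ :=
        fun x => by
      have hHS : ∀ i, ‖P.covDiff Q x (b i)‖ ^ 2 =
          ⟪P.cov x (P.covDiff Q x (b i)), b i⟫ - ⟪Q.cov x (P.covDiff Q x (b i)), b i⟫ := fun i => by
        rw [← real_inner_self_eq_norm_sq, inner_covDiff_comm, covDiff, sub_apply, sub_apply,
          inner_sub_left]
      simp_rw [hHS]
      rw [← Finset.mul_sum, Finset.sum_sub_distrib, Finset.sum_sub_distrib, sum_inner_covDeriv,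
        sum_inner_covDeriv, real_inner_smul_left]
      have h1 : ⟪P.covDiff Q x (P.meanDiff Q x), P.mean x⟫ =
          ⟪P.cov x (P.meanDiff Q x), P.mean x⟫ - ⟪Q.cov x (P.meanDiff Q x), P.mean x⟫ :=
        inner_sub_left _ _ _
      have h2 : ⟪Q.cov x (P.meanDiff Q x), P.meanDiff Q x⟫ =
          ⟪Q.cov x (P.meanDiff Q x), P.mean x⟫ - ⟪Q.cov x (P.meanDiff Q x), Q.mean x⟫ :=
        inner_sub_right _ _ _
      rw [h1, h2]
      ring
    simp_rw [hp] at hint hder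
    -- The prefactor t⁻² supplies the -1/t in the curvature bound.
    have hsq : HasDerivAt (fun t : ℝ => (t ^ 2)⁻¹) (-(2 * t) / (t ^ 2) ^ 2) t := by
      refine ((hasDerivAt_pow 2 t).inv (pow_ne_zero 2 ht.ne')).congr_deriv ?_
      norm_num
    refine ⟨_, (hsq.mul hder).congr_of_eventuallyEq ?_, ?_⟩
    · filter_upwards [Ioi_mem_nhds ht] with u hu
      exact hμ.fisherFlow_eq hν hr hu
    · rw [hμ.fisherFlow_eq hν hr ht]
      -- The Hilbert–Schmidt square is discarded. A lower bound is what is needed, since d/dt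
      -- carries the factor -t⁻².
      have hle : ∫ x, -(2 * Λ) * (density μ (√t) x * ‖P.meanDiff Q (t⁻¹ • x)‖ ^ 2) ≤
          ∫ x, density μ (√t) x * (∑ i, ‖P.covDiff Q (t⁻¹ • x) (b i)‖ ^ 2 -
            2 * ⟪Q.cov (t⁻¹ • x) (P.meanDiff Q (t⁻¹ • x)), P.meanDiff Q (t⁻¹ • x)⟫) := by
        refine integral_mono ((hμ.integrable_norm_sq_meanDiff hr ht).const_mul _) hint fun x => ?_
        have h1 := hΛ (t⁻¹ • x) (P.meanDiff Q (t⁻¹ • x))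
        have h2 : 0 ≤ ∑ i, ‖P.covDiff Q (t⁻¹ • x) (b i)‖ ^ 2 :=
          Finset.sum_nonneg fun i _ => sq_nonneg _
        have h3 := (hμ.density_pos (Real.sqrt_pos.2 ht) x).le
        simp only
        rw [mul_left_comm]
        exact mul_le_mul_of_nonneg_left (by linarith) h3
      rw [integral_const_mul] at hle
      have h4 : 0 ≤ (t ^ 2)⁻¹ * (t ^ 2)⁻¹ := by positivity
      have h5 := mul_le_mul_of_nonneg_left hle h4
      have h6 : -(2 * t) / (t ^ 2) ^ 2 = -2 * (1 / t) * (t ^ 2)⁻¹ := by field_simp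
      rw [h6]
      have h7 : Λ / t ^ 2 = Λ * (t ^ 2)⁻¹ := div_eq_mul_inv _ _
      rw [h7]
      linarith
  · rw [norm_smul, Real.norm_of_nonneg two_pos.le]
    have := hD x
    gcongr
    exact (norm_covDiff_apply_le hr x (P.meanDiff Q x)).trans (by gcongr)
  · have hc := hasDerivAt_add_smul x (b i)
    have h1 := (P.hasFDerivAt_meanDiff Q (x + (0 : ℝ) • _)).comp_hasDerivAt (0 : ℝ) hc
    have h2 := (((P.hasDerivAt_cov_apply hc h1).sub (Q.hasDerivAt_cov_apply hc h1)).const_smul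
      (2 : ℝ)).inner ℝ (hasDerivAt_const (0 : ℝ) (b i))
    refine h2.congr_deriv ?_
    simp only [Function.comp, zero_smul, add_zero, inner_zero_right, zero_add, covDeriv,
      real_inner_smul_left, inner_sub_left]
  · have hc := P.continuous_covDiff_apply Q (continuous_const (y := b i))
    exact ((((continuous_covDeriv (P.continuous_meanDiff Q) hc).inner continuous_const).sub
      ((continuous_covDeriv (P.continuous_meanDiff Q) hc).inner continuous_const)).const_mul
      2).measurable
  · have hH' := hH x i
    rw [hb, mul_one] at hH'
    have h1 := norm_covDeriv_le (P := P) (z := x) (hb i) (by rw [hr]; exact hD x)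
      (by rw [hr]; exact hH')
    have h2 := norm_covDeriv_le (P := Q) (z := x) (hb i) (hD x) hH'
    rw [← inner_sub_left, abs_mul, abs_two]
    refine mul_le_mul_of_nonneg_left ((abs_real_inner_le_norm _ _).trans ?_) two_pos.le
    rw [hb, mul_one]
    rw [hr] at h1
    exact (norm_sub_le _ _).trans (add_le_add h1 h2)

end SphereMixture

end KLFisher

namespace KLFisher

local notation "⟪" x ", " y "⟫" => inner ℝ x y

/-! ### The largest eigenvalue and the curvature of a smoothed mixture -/

section LambdaMax

variable {d : ℕ} [NeZero d] {T : EuclideanSpace ℝ (Fin d) →L[ℝ] EuclideanSpace ℝ (Fin d)}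

/-- For symmetric T on a nonzero finite-dimensional space the supremum of the Rayleigh quotient is
itself an eigenvalue. This makes the set in `lambdaMax` nonempty, and ‖T‖ bounds it. -/
theorem lambdaMax_le_iff (hT : ∀ u v, ⟪T u, v⟫ = ⟪T v, u⟫) (c : ℝ) :
    lambdaMax T ≤ c ↔ ∀ v, ⟪T v, v⟫ ≤ c * ‖v‖ ^ 2 := by
  have hsym : (T : EuclideanSpace ℝ (Fin d) →ₗ[ℝ] EuclideanSpace ℝ (Fin d)).IsSymmetric :=
    fun u v => by
      change ⟪T u, v⟫ = ⟪u, T v⟫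
      rw [hT, real_inner_comm]
  have heig := hsym.hasEigenvalue_iSup_of_finiteDimensional
  have hbound : ∀ e ∈ {c : ℝ | Module.End.HasEigenvalue
      (T : EuclideanSpace ℝ (Fin d) →ₗ[ℝ] EuclideanSpace ℝ (Fin d)) c}, ∀ c : ℝ,
      (∀ v, ⟪T v, v⟫ ≤ c * ‖v‖ ^ 2) → e ≤ c := by
    intro e he c hc
    obtain ⟨v, hv⟩ := Module.End.HasEigenvalue.exists_hasEigenvector he
    have h1 : T v = e • v := hv.apply_eq_smul
    have h2 := hc v
    rw [h1, real_inner_smul_left, real_inner_self_eq_norm_sq] at h2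
    exact le_of_mul_le_mul_right h2 (pow_pos (norm_pos_iff.2 hv.2) 2)
  have hnorm : ∀ v, ⟪T v, v⟫ ≤ ‖T‖ * ‖v‖ ^ 2 := fun v => by
    refine (real_inner_le_norm _ _).trans ?_
    rw [sq, ← mul_assoc]
    exact mul_le_mul_of_nonneg_right (T.le_opNorm v) (norm_nonneg v)
  constructor
  · intro h v
    refine le_trans ?_ (mul_le_mul_of_nonneg_right h (sq_nonneg _))
    rcases eq_or_ne v 0 with rfl | hv
    · simp
    have h1 : (⨆ x : {x : EuclideanSpace ℝ (Fin d) // x ≠ 0},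
        ⟪T x, (x : EuclideanSpace ℝ (Fin d))⟫ / ‖(x : EuclideanSpace ℝ (Fin d))‖ ^ 2) ≤
          lambdaMax T :=
      le_csSup ⟨‖T‖, fun e he => hbound e he _ hnorm⟩ heig
    have h2 : ⟪T v, v⟫ / ‖v‖ ^ 2 ≤ ⨆ x : {x : EuclideanSpace ℝ (Fin d) // x ≠ 0},
        ⟪T x, (x : EuclideanSpace ℝ (Fin d))⟫ / ‖(x : EuclideanSpace ℝ (Fin d))‖ ^ 2 := by
      refine le_ciSup (f := fun x : {x : EuclideanSpace ℝ (Fin d) // x ≠ 0} =>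
        ⟪T x, (x : EuclideanSpace ℝ (Fin d))⟫ / ‖(x : EuclideanSpace ℝ (Fin d))‖ ^ 2)
        ⟨‖T‖, ?_⟩ ⟨v, hv⟩
      rintro _ ⟨x, rfl⟩
      exact (div_le_iff₀ (pow_pos (norm_pos_iff.2 x.2) 2)).2 (hnorm x)
    exact (div_le_iff₀ (pow_pos (norm_pos_iff.2 hv) 2)).1 (h2.trans h1)
  · exact fun h => csSup_le ⟨_, heig⟩ fun e he => hbound e he c h

/-- Both sides have the same real upper bounds, by the quadratic-form criterion. -/
theorem lambdaMax_smul_sub (hT : ∀ u v, ⟪T u, v⟫ = ⟪T v, u⟫) {a : ℝ} (ha : 0 < a) :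
    lambdaMax (a • (a • T - ContinuousLinearMap.id ℝ _)) = a * (a * lambdaMax T - 1) := by
  have hT' : ∀ u v, ⟪(a • (a • T - ContinuousLinearMap.id ℝ (EuclideanSpace ℝ (Fin d)))) u, v⟫ =
      a * (a * ⟪T u, v⟫ - ⟪u, v⟫) := fun u v => by
    simp [real_inner_smul_left, inner_sub_left]
  have hc : ∀ c : ℝ, lambdaMax (a • (a • T - ContinuousLinearMap.id ℝ _)) ≤ c ↔
      a * (a * lambdaMax T - 1) ≤ c := fun c => by
    have h1 : a * (a * lambdaMax T - 1) ≤ c ↔ lambdaMax T ≤ (c / a + 1) / a := by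
      rw [le_div_iff₀ ha, ← sub_le_iff_le_add, le_div_iff₀ ha, mul_comm a (_ - 1),
        mul_comm a (lambdaMax T)]
    rw [h1, lambdaMax_le_iff hT, lambdaMax_le_iff fun u v => by
      rw [hT', hT', hT u v, real_inner_comm u v]]
    refine forall_congr' fun v => ?_
    rw [hT', real_inner_self_eq_norm_sq, ← mul_le_mul_iff_right₀ (pow_pos ha 2)
      (b := ⟪T v, v⟫)]
    have : a ^ 2 * ((c / a + 1) / a * ‖v‖ ^ 2) = (c + a) * ‖v‖ ^ 2 := by field_simp
    rw [this]
    constructor <;> intro h <;> linarith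
  exact le_antisymm ((hc _).2 le_rfl) ((hc _).1 le_rfl)

end LambdaMax

namespace SphereMixture

variable {d : ℕ} [NeZero d] {κ : Type*} [Fintype κ]
  {Q : SphereMixture (EuclideanSpace ℝ (Fin d)) κ} {ν : Measure (EuclideanSpace ℝ (Fin d))}

variable (Q) in
/-- The supremum of the largest eigenvalue of the tilted covariances. -/
noncomputable def maxCov : ℝ := ⨆ z, lambdaMax (Q.cov z)

theorem lambdaMax_cov_le {c : ℝ} (hc : ∀ z v, ⟪Q.cov z v, v⟫ ≤ c * ‖v‖ ^ 2)
    (z : EuclideanSpace ℝ (Fin d)) : lambdaMax (Q.cov z) ≤ c :=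
  (lambdaMax_le_iff (Q.inner_cov_comm z) c).2 (hc z)

theorem bddAbove_lambdaMax_cov : BddAbove (Set.range fun z => lambdaMax (Q.cov z)) := by
  refine ⟨Q.r ^ 2, ?_⟩
  rintro _ ⟨z, rfl⟩
  exact lambdaMax_cov_le Q.inner_cov_self_le z

theorem maxCov_le {c : ℝ} (hc : ∀ z v, ⟪Q.cov z v, v⟫ ≤ c * ‖v‖ ^ 2) : Q.maxCov ≤ c :=
  ciSup_le (lambdaMax_cov_le hc)

theorem inner_cov_self_le_maxCov (z v : EuclideanSpace ℝ (Fin d)) :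
    ⟪Q.cov z v, v⟫ ≤ Q.maxCov * ‖v‖ ^ 2 :=
  (lambdaMax_le_iff (Q.inner_cov_comm z) _).1 (le_ciSup Q.bddAbove_lambdaMax_cov z) v

theorem IsLaw.maxCurvature_eq (hν : Q.IsLaw ν) {t : ℝ} (ht : 0 < t)
    (x : EuclideanSpace ℝ (Fin d)) :
    maxCurvature ν t x = t⁻¹ * (t⁻¹ * lambdaMax (Q.cov (t⁻¹ • x)) - 1) := by
  have h : fderiv ℝ (gradient fun z => Real.log (density ν (√t) z)) x = _ :=
    (hν.hasFDerivAt_score (Real.sqrt_pos.2 ht) x).fderiv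
  rw [maxCurvature, h, Real.sq_sqrt ht.le,
    lambdaMax_smul_sub (Q.inner_cov_comm _) (inv_pos.2 ht)]

theorem IsLaw.bddAbove_maxCurvature (hν : Q.IsLaw ν) {t : ℝ} (ht : 0 < t) :
    BddAbove (Set.range (maxCurvature ν t)) := by
  refine ⟨t⁻¹ * (t⁻¹ * Q.maxCov - 1), ?_⟩
  rintro _ ⟨x, rfl⟩
  rw [hν.maxCurvature_eq ht]
  have := le_ciSup Q.bddAbove_lambdaMax_cov (t⁻¹ • x)
  rw [← maxCov] at this
  have := inv_pos.2 ht
  gcongr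

/-- As x runs over the whole space so does z = x/t, so the supremum of the covariance does not
depend on t. This explicit form also yields continuity of `rhoPlus`. -/
theorem IsLaw.rho_eq (hν : Q.IsLaw ν) {t : ℝ} (ht : 0 < t) :
    rho ν t = Q.maxCov / t ^ 2 - 1 / t := by
  have h1 : Q.maxCov / t ^ 2 - 1 / t = t⁻¹ * (t⁻¹ * Q.maxCov - 1) := by
    field_simp
  rw [h1]
  refine le_antisymm (ciSup_le fun x => ?_) ?_
  · rw [hν.maxCurvature_eq ht]
    have := le_ciSup Q.bddAbove_lambdaMax_cov (t⁻¹ • x)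
    rw [← maxCov] at this
    have := inv_pos.2 ht
    gcongr
  · have h2 : Q.maxCov ≤ t * (t * rho ν t + 1) := ciSup_le fun z => by
      have h3 : maxCurvature ν t (t • z) ≤ rho ν t :=
        le_ciSup (hν.bddAbove_maxCurvature ht) (t • z)
      rw [hν.maxCurvature_eq ht, smul_smul, inv_mul_cancel₀ ht.ne', one_smul,
        inv_mul_le_iff₀ ht, sub_le_iff_le_add, inv_mul_le_iff₀ ht] at h3
      exact h3
    rw [inv_mul_le_iff₀ ht, sub_le_iff_le_add, inv_mul_le_iff₀ ht]
    exact h2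

theorem IsLaw.rhoPlus_le (hν : Q.IsLaw ν) {R : ℝ}
    (hR : ∀ z v, ⟪Q.cov z v, v⟫ ≤ R ^ 2 * ‖v‖ ^ 2) {t : ℝ} (ht : 0 < t) :
    rhoPlus ν t ≤ R ^ 2 / t ^ 2 := by
  refine max_le ?_ (by positivity)
  rw [hν.rho_eq ht]
  have h1 := maxCov_le hR
  have h2 : 0 ≤ 1 / t := by positivity
  have h3 : Q.maxCov / t ^ 2 ≤ R ^ 2 / t ^ 2 := by gcongr
  linarith

theorem IsLaw.continuousOn_rhoPlus (hν : Q.IsLaw ν) : ContinuousOn (rhoPlus ν) (Set.Ioi 0) := by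
  have h : ContinuousOn (fun t : ℝ => max (Q.maxCov / t ^ 2 - 1 / t) 0) (Set.Ioi 0) := by
    refine ContinuousOn.sup (ContinuousOn.sub ?_ ?_) continuousOn_const
    · exact continuousOn_const.div (by fun_prop) fun t ht => (pow_pos ht 2).ne'
    · exact continuousOn_const.div (by fun_prop) fun t ht => (Set.mem_Ioi.1 ht).ne'
  refine h.congr fun t ht => ?_
  rw [rhoPlus, hν.rho_eq ht]

end SphereMixture

/-! ### Integration of the differential inequality -/

/-- Gronwall: the integrating factor exp(-2∫ρ) makes the product with J nonincreasing. -/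
theorem le_exp_integral_mul_of_deriv_le {J ρ : ℝ → ℝ} {a b : ℝ} (ha : 0 < a) (hab : a ≤ b)
    (hρ : ContinuousOn ρ (Set.Ioi 0))
    (hJ : ∀ t, 0 < t → ∃ J', HasDerivAt J J' t ∧ J' ≤ 2 * ρ t * J t) :
    J b ≤ Real.exp (2 * ∫ s in a..b, ρ s) * J a := by
  choose! J' hJ' using hJ
  have hint : ∀ t, a ≤ t → IntervalIntegrable ρ volume a t := fun t hat =>
    (hρ.mono fun s hs => by
      rw [Set.uIcc_of_le hat] at hs
      exact ha.trans_le hs.1).intervalIntegrable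
  have hder : ∀ t, a ≤ t → HasDerivAt (fun t => Real.exp (-(2 * ∫ s in a..t, ρ s)) * J t)
      (Real.exp (-(2 * ∫ s in a..t, ρ s)) * -(2 * ρ t) * J t +
        Real.exp (-(2 * ∫ s in a..t, ρ s)) * J' t) t := fun t hat => by
    have ht := ha.trans_le hat
    have h1 := intervalIntegral.integral_hasDerivAt_right (hint t hat)
      (hρ.stronglyMeasurableAtFilter isOpen_Ioi t ht) (hρ.continuousAt (Ioi_mem_nhds ht))
    exact ((h1.const_mul 2).neg.exp).mul (hJ' t ht).1
  have hanti : AntitoneOn (fun t => Real.exp (-(2 * ∫ s in a..t, ρ s)) * J t) (Set.Icc a b) := by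
    refine antitoneOn_of_hasDerivWithinAt_nonpos (convex_Icc a b)
      (fun t ht => (hder t ht.1).continuousAt.continuousWithinAt)
      (fun t ht => (hder t (interior_subset ht).1).hasDerivWithinAt) fun t ht => ?_
    have h2 := (hJ' t (ha.trans_le (interior_subset ht).1)).2
    have h3 := Real.exp_pos (-(2 * ∫ s in a..t, ρ s))
    nlinarith
  have h := hanti (Set.left_mem_Icc.2 hab) (Set.right_mem_Icc.2 hab) hab
  simp only [intervalIntegral.integral_same, mul_zero, neg_zero, Real.exp_zero, one_mul] at h
  rw [Real.exp_neg, inv_mul_le_iff₀ (Real.exp_pos _)] at h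
  exact h

/-- The mean value theorem gives ξ with J ξ equal to twice the average decay rate of D, and D b ≥ 0
may be dropped. Gronwall carries the bound from ξ to b; as ρ ≥ 0, its integral may start at a. -/
theorem le_mul_exp_integral_mul_of_deriv {D J ρ : ℝ → ℝ} {a b : ℝ} (ha : 0 < a) (hab : a < b)
    (hρ : ContinuousOn ρ (Set.Ioi 0)) (hρ0 : ∀ t, 0 ≤ ρ t) (hD0 : 0 ≤ D b) (hJ0 : ∀ t, 0 ≤ J t)
    (hD : ∀ t, 0 < t → HasDerivAt D (-(1 / 2) * J t) t)
    (hJ : ∀ t, 0 < t → ∃ J', HasDerivAt J J' t ∧ J' ≤ 2 * ρ t * J t) :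
    J b ≤ 2 / (b - a) * Real.exp (2 * ∫ s in a..b, ρ s) * D a := by
  obtain ⟨ξ, hξ, hξ'⟩ := exists_hasDerivAt_eq_slope D (fun t => -(1 / 2) * J t) hab
    (fun t ht => (hD t (ha.trans_le ht.1)).continuousAt.continuousWithinAt)
    fun t ht => hD t (ha.trans ht.1)
  have hba : 0 < b - a := sub_pos.2 hab
  have h1 : J ξ ≤ 2 / (b - a) * D a := by
    have : J ξ = 2 / (b - a) * (D a - D b) := by
      have : J ξ = -2 * ((D b - D a) / (b - a)) := by rw [← hξ']; ring
      rw [this]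
      ring
    rw [this]
    exact mul_le_mul_of_nonneg_left (by linarith) (by positivity)
  have hξ0 := ha.trans hξ.1
  have hint : ∀ s t, 0 < s → s ≤ t → IntervalIntegrable ρ volume s t := fun s t hs hst =>
    (hρ.mono fun u hu => by
      rw [Set.uIcc_of_le hst] at hu
      exact hs.trans_le hu.1).intervalIntegrable
  have h2 : ∫ s in ξ..b, ρ s ≤ ∫ s in a..b, ρ s := by
    rw [← intervalIntegral.integral_add_adjacent_intervals (hint a ξ ha hξ.1.le)
      (hint ξ b hξ0 hξ.2.le)]
    have := intervalIntegral.integral_nonneg (μ := volume) hξ.1.le fun u _ => hρ0 u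
    linarith
  calc J b ≤ Real.exp (2 * ∫ s in ξ..b, ρ s) * J ξ :=
        le_exp_integral_mul_of_deriv_le hξ0 hξ.2.le hρ hJ
    _ ≤ Real.exp (2 * ∫ s in a..b, ρ s) * (2 / (b - a) * D a) :=
        mul_le_mul (Real.exp_le_exp.2 (by linarith)) h1 (hJ0 ξ) (Real.exp_pos _).le
    _ = _ := by ring

end KLFisher

namespace KLFisher

local notation "⟪" x ", " y "⟫" => inner ℝ x y

/-! ### The null law and the empirical laws as mixtures -/

namespace SphereMixture

/-- The uniform mixture on a finite subset of a sphere. -/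
noncomputable def uniform {V : Type*} [NormedAddCommGroup V] [InnerProductSpace ℝ V] (s : Set V)
    [Fintype s] (hs : s.Nonempty) (r : ℝ) (hr : ∀ y ∈ s, ‖y‖ = r) : SphereMixture V s where
  w _ := (Fintype.card s : ℝ)⁻¹
  Y y := y
  r := r
  w_pos _ := by
    have := hs.to_subtype
    have : 0 < Fintype.card s := Fintype.card_pos
    positivity
  sum_w := by
    have := hs.to_subtype
    have : (Fintype.card s : ℝ) ≠ 0 := Nat.cast_ne_zero.2 Fintype.card_ne_zero
    rw [Finset.sum_const, Finset.card_univ, nsmul_eq_mul, mul_inv_cancel₀ this]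
  norm_Y y := hr y y.2

theorem isLaw_uniform {d : ℕ} (s : Set (EuclideanSpace ℝ (Fin d))) [Fintype s] (hs : s.Nonempty)
    (r : ℝ) (hr : ∀ y ∈ s, ‖y‖ = r) : (uniform s hs r hr).IsLaw (uniformOn s) := by
  intro f
  have hfin : s.Finite := s.toFinite
  have hint : IntegrableOn f s Measure.count := by
    have h1 : ∀ y ∈ s, IntegrableOn f {y} Measure.count := fun y _ =>
      integrableOn_singleton (by simp) (by rw [Measure.count_singleton]; exact ENNReal.one_lt_top)
    have h2 := (integrableOn_finite_biUnion hfin (f := f) (μ := Measure.count)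
      (t := fun y => ({y} : Set (EuclideanSpace ℝ (Fin d))))).2 h1
    rwa [Set.biUnion_of_singleton] at h2
  rw [uniformOn, ProbabilityTheory.cond, integral_smul_measure,
    setIntegral_countable f hfin.countable hint, tsum_fintype, Finset.smul_sum]
  refine Finset.sum_congr rfl fun y _ => ?_
  simp [uniform, Measure.count_apply_finite' hfin hfin.measurableSet, Measure.real,
    Set.toFinite_toFinset]

/-- The empirical mixture of a codebook. -/
noncomputable def codebook {V : Type*} [NormedAddCommGroup V] [InnerProductSpace ℝ V] {n : ℕ}
    (hn : 0 < n) (S : Fin n → V) (r : ℝ) (hr : ∀ i, ‖S i‖ = r) : SphereMixture V (Fin n) where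
  w _ := (n : ℝ)⁻¹
  Y := S
  r := r
  w_pos _ := by positivity
  sum_w := by
    have : (n : ℝ) ≠ 0 := Nat.cast_ne_zero.2 hn.ne'
    simp [this]
  norm_Y := hr

theorem isLaw_codebook {d n : ℕ} (hn : 0 < n) (S : Fin n → EuclideanSpace ℝ (Fin d)) (r : ℝ)
    (hr : ∀ i, ‖S i‖ = r) : (codebook hn S r hr).IsLaw (empirical S) := by
  intro f
  rw [empirical, integral_smul_measure,
    integral_finsetSum_measure fun i _ => integrable_dirac (by simp), Finset.smul_sum]
  simp [codebook]

end SphereMixture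

theorem isProbabilityMeasure_empirical {d n : ℕ} (hn : 0 < n)
    (S : Fin n → EuclideanSpace ℝ (Fin d)) : IsProbabilityMeasure (empirical S) := by
  constructor
  have h1 : (n : ℝ≥0∞) ≠ 0 := Nat.cast_ne_zero.2 hn.ne'
  simp [empirical, ENNReal.inv_mul_cancel h1]

/-! ### Planar blocks and the product structure of the null law -/

section Blocks

variable {m : ℕ}

theorem sum_fin_two_mul (f : Fin (2 * m) → ℝ) :
    ∑ i, f i = ∑ j : Fin m, (f ⟨2 * j, by omega⟩ + f ⟨2 * j + 1, by omega⟩) := by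
  rw [← ((finProdFinEquiv (m := m) (n := 2)).trans (finCongr (mul_comm m 2))).sum_comp f,
    Fintype.sum_prod_type]
  refine Finset.sum_congr rfl fun j _ => ?_
  rw [Fin.sum_univ_two]
  congr 2
  · ext
    simp [finProdFinEquiv]
  · ext
    simp [finProdFinEquiv, add_comm]

theorem inner_eq_sum_block (y z : EuclideanSpace ℝ (Fin (2 * m))) :
    ⟪y, z⟫ = ∑ j, ⟪block y j, block z j⟫ := by
  simp only [PiLp.inner_apply, Fin.sum_univ_two]
  rw [sum_fin_two_mul]
  simp [block]

theorem norm_sq_eq_sum_block (y : EuclideanSpace ℝ (Fin (2 * m))) :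
    ‖y‖ ^ 2 = ∑ j, ‖block y j‖ ^ 2 := by
  simp_rw [← real_inner_self_eq_norm_sq]
  exact inner_eq_sum_block y y

theorem block_add_smul (x v : EuclideanSpace ℝ (Fin (2 * m))) (ε : ℝ) (j : Fin m) :
    block (x + ε • v) j = block x j + ε • block v j := by
  ext k
  fin_cases k <;> simp [block]

theorem block_injective :
    Function.Injective fun (y : EuclideanSpace ℝ (Fin (2 * m))) j => block y j := by
  intro y z h
  rw [← sub_eq_zero, ← norm_eq_zero, ← sq_eq_zero_iff, norm_sq_eq_sum_block]
  refine Finset.sum_eq_zero fun j _ => ?_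
  have h1 : block (y + (-1 : ℝ) • z) j = block y j + (-1 : ℝ) • block z j :=
    block_add_smul _ _ _ _
  have h2 : block y j = block z j := congrFun h j
  rw [sub_eq_add_neg, ← neg_one_smul ℝ z, h1, h2]
  simp

theorem exists_block_eq (f : Fin m → EuclideanSpace ℝ (Fin 2)) :
    ∃ y : EuclideanSpace ℝ (Fin (2 * m)), ∀ j, block y j = f j := by
  refine ⟨WithLp.toLp 2 fun i => f ⟨i / 2, by omega⟩ ⟨i % 2, by omega⟩, fun j => ?_⟩
  ext k
  fin_cases k
  · simp [block]
  · have h1 : (2 * (j : ℕ) + 1) / 2 = j := by omega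
    have h2 : (2 * (j : ℕ) + 1) % 2 = 1 := by omega
    simp [block, h1, h2]

variable {R γ : ℝ}

/-- A point of the product circle is the family of its blocks. -/
noncomputable def productCircleEquiv (m : ℕ) (R γ : ℝ) :
    productCircle m R γ ≃ (Fin m → circlePoints R γ) :=
  Equiv.ofBijective (fun y j => ⟨block y.1 j, y.2 j⟩) ⟨fun y z h => by
    refine Subtype.ext (block_injective (funext fun j => ?_))
    exact congrArg Subtype.val (congrFun h j), fun f => by
    obtain ⟨y, hy⟩ := exists_block_eq fun j => (f j : EuclideanSpace ℝ (Fin 2))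
    exact ⟨⟨y, fun j => by rw [hy]; exact (f j).2⟩, funext fun j => Subtype.ext (hy j)⟩⟩

noncomputable instance fintypeCirclePoints : Fintype (circlePoints R γ) :=
  (Set.finite_range _).fintype

noncomputable instance fintypeProductCircle : Fintype (productCircle m R γ) :=
  (productCircle_finite m R γ).fintype

theorem circlePoints_nonempty (hR : 0 < R) (hγ : 0 < γ) : (circlePoints R γ).Nonempty := by
  obtain ⟨y, hy⟩ := productCircle_nonempty 1 hR hγ
  exact ⟨_, hy 0⟩

theorem norm_of_mem_circlePoints (hR : 0 < R) : ∀ a ∈ circlePoints R γ, ‖a‖ = R := by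
  rintro _ ⟨k, rfl⟩
  rw [← sq_eq_sq₀ (norm_nonneg _) hR.le, EuclideanSpace.real_norm_sq_eq, Fin.sum_univ_two]
  simp only [Matrix.cons_val_zero, Matrix.cons_val_one]
  linear_combination R ^ 2 * Real.cos_sq_add_sin_sq (2 * Real.pi * (k : ℕ) / numPoints R γ)

theorem norm_of_mem_productCircle (hR : 0 < R) :
    ∀ y ∈ productCircle m R γ, ‖y‖ = √(m * R ^ 2) := by
  intro y hy
  rw [← Real.sqrt_sq (norm_nonneg y), norm_sq_eq_sum_block]
  simp_rw [norm_of_mem_circlePoints hR _ (hy _)]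
  simp

/-- The uniform mixture on the circle points. -/
noncomputable def circleMixture (hR : 0 < R) (hγ : 0 < γ) :
    SphereMixture (EuclideanSpace ℝ (Fin 2)) (circlePoints R γ) :=
  .uniform (circlePoints R γ) (circlePoints_nonempty hR hγ) R (norm_of_mem_circlePoints hR)

/-- The uniform mixture on the product circle. -/
noncomputable def nullMixture (m : ℕ) (hR : 0 < R) (hγ : 0 < γ) :
    SphereMixture (EuclideanSpace ℝ (Fin (2 * m))) (productCircle m R γ) :=
  .uniform (productCircle m R γ) (productCircle_nonempty m hR hγ) (√(m * R ^ 2))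
    (norm_of_mem_productCircle hR)

/-- Uniform on a product set means independent uniform blocks, and the exponential of a sum factors.
-/
theorem laplace_nullMixture (hR : 0 < R) (hγ : 0 < γ) (z : EuclideanSpace ℝ (Fin (2 * m))) :
    (nullMixture m hR hγ).laplace z = ∏ j, (circleMixture hR hγ).laplace (block z j) := by
  have hcard : Fintype.card (productCircle m R γ) = Fintype.card (circlePoints R γ) ^ m := by
    rw [Fintype.card_congr (productCircleEquiv m R γ)]
    simp
  simp only [SphereMixture.laplace, nullMixture, circleMixture, SphereMixture.uniform]
  rw [Finset.prod_univ_sum, Fintype.piFinset_univ, ← (productCircleEquiv m R γ).sum_comp]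
  refine Finset.sum_congr rfl fun y _ => ?_
  rw [Finset.prod_mul_distrib, ← Real.exp_sum, inner_eq_sum_block, hcard, Finset.prod_const,
    Finset.card_univ, Fintype.card_fin, Nat.cast_pow, inv_pow]
  rfl

/-- Obtained by differentiating the logarithm of the factored Laplace transform along a line; one
more derivative gives the covariance. -/
theorem inner_mean_nullMixture (hR : 0 < R) (hγ : 0 < γ)
    (z v : EuclideanSpace ℝ (Fin (2 * m))) :
    ⟪(nullMixture m hR hγ).mean z, v⟫ =
      ∑ j, ⟪(circleMixture hR hγ).mean (block z j), block v j⟫ := by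
  have h1 := ((nullMixture m hR hγ).hasFDerivAt_log_laplace (z + (0 : ℝ) • v)).comp_hasDerivAt
    (0 : ℝ) (SphereMixture.hasDerivAt_add_smul z v)
  have h2 := HasDerivAt.fun_sum (u := Finset.univ) fun j _ =>
    ((circleMixture hR hγ).hasFDerivAt_log_laplace (block z j + (0 : ℝ) • block v j)).comp_hasDerivAt
      (0 : ℝ) (SphereMixture.hasDerivAt_add_smul (block z j) (block v j))
  have h3 := h1.unique (h2.congr_of_eventuallyEq (Filter.Eventually.of_forall fun ε => ?_))
  · simpa using h3
  · simp only [Function.comp]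
    rw [laplace_nullMixture, Real.log_prod fun j _ => (SphereMixture.laplace_pos _ _).ne']
    simp_rw [block_add_smul]

theorem inner_cov_nullMixture (hR : 0 < R) (hγ : 0 < γ)
    (z v : EuclideanSpace ℝ (Fin (2 * m))) :
    ⟪(nullMixture m hR hγ).cov z v, v⟫ =
      ∑ j, ⟪(circleMixture hR hγ).cov (block z j) (block v j), block v j⟫ := by
  have h1 := (((nullMixture m hR hγ).hasFDerivAt_mean (z + (0 : ℝ) • v)).comp_hasDerivAt
    (0 : ℝ) (SphereMixture.hasDerivAt_add_smul z v)).inner ℝ (hasDerivAt_const (0 : ℝ) v)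
  have h2 := HasDerivAt.fun_sum (u := Finset.univ) fun j _ =>
    (((circleMixture hR hγ).hasFDerivAt_mean (block z j + (0 : ℝ) • block v j)).comp_hasDerivAt
      (0 : ℝ) (SphereMixture.hasDerivAt_add_smul (block z j) (block v j))).inner ℝ
        (hasDerivAt_const (0 : ℝ) (block v j))
  have h3 := h1.unique (h2.congr_of_eventuallyEq (Filter.Eventually.of_forall fun ε => ?_))
  · simpa using h3
  · simp only [Function.comp]
    rw [inner_mean_nullMixture]
    simp_rw [block_add_smul]

/-- Working block by block gives R², whereas the sphere containing the full support would give only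
m R². -/
theorem inner_cov_nullMixture_self_le (hR : 0 < R) (hγ : 0 < γ)
    (z v : EuclideanSpace ℝ (Fin (2 * m))) :
    ⟪(nullMixture m hR hγ).cov z v, v⟫ ≤ R ^ 2 * ‖v‖ ^ 2 := by
  rw [inner_cov_nullMixture, norm_sq_eq_sum_block, Finset.mul_sum]
  exact Finset.sum_le_sum fun j _ => (circleMixture hR hγ).inner_cov_self_le _ _

theorem isLaw_nullMixture (m : ℕ) (hR : 0 < R) (hγ : 0 < γ) :
    (nullMixture m hR hγ).IsLaw (nullLaw m R γ) :=
  SphereMixture.isLaw_uniform _ _ _ _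

theorem isProbabilityMeasure_nullLaw (m : ℕ) (hR : 0 < R) (hγ : 0 < γ) :
    IsProbabilityMeasure (nullLaw m R γ) :=
  isProbabilityMeasure_uniformOn (productCircle_finite m R γ) (productCircle_nonempty m hR hγ)

end Blocks

end KLFisher

namespace KLFisher

/-! ### The integrated inequality and the score error -/

namespace SphereMixture

variable {d : ℕ} {ι κ : Type*} [Fintype ι] [Fintype κ]
  {P : SphereMixture (EuclideanSpace ℝ (Fin d)) ι} {Q : SphereMixture (EuclideanSpace ℝ (Fin d)) κ}
  {μ ν : Measure (EuclideanSpace ℝ (Fin d))}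

theorem fisherFlow_nonneg (μ ν : Measure (EuclideanSpace ℝ (Fin d))) (t : ℝ) :
    0 ≤ fisherFlow μ ν t :=
  integral_nonneg fun x => mul_nonneg
    (integral_nonneg fun y => by unfold gaussianDensity; positivity) (sq_nonneg _)

theorem IsLaw.scoreError_eq_fisherFlow [IsProbabilityMeasure μ] (hμ : P.IsLaw μ) (hν : Q.IsLaw ν)
    (hr : P.r = Q.r) {τ : ℝ} (hτ : 0 < τ) :
    Integrable (fun x => ‖score μ τ x - score ν τ x‖ ^ 2) (smoothed μ τ) ∧
      scoreError μ ν τ = fisherFlow μ ν (τ ^ 2) := by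
  have h := hμ.integrable_smoothed_iff hτ fun x => ‖score μ τ x - score ν τ x‖ ^ 2
  have hx : ∀ x, density μ τ x * ‖score μ τ x - score ν τ x‖ ^ 2 =
      fisherIntegrand μ ν (τ ^ 2) x := fun x => by
    rw [hμ.fisherIntegrand_eq hν hr (pow_pos hτ 2), Real.sqrt_sq hτ.le, hμ.score_sub_score hν hτ,
      norm_smul, mul_pow, Real.norm_eq_abs, sq_abs]
    ring
  simp_rw [hx] at h
  exact ⟨h.1.2 (hμ.integrable_fisherIntegrand hν hr (pow_pos hτ 2)), h.2⟩

variable [NeZero d]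

theorem IsLaw.exists_hasDerivAt_fisherFlow_le (hμ : P.IsLaw μ) (hν : Q.IsLaw ν) (hr : P.r = Q.r)
    {t : ℝ} (ht : 0 < t) : ∃ J' : ℝ, HasDerivAt (fisherFlow μ ν) J' t ∧
      J' ≤ 2 * rhoPlus ν t * fisherFlow μ ν t := by
  obtain ⟨J', h1, h2⟩ := hμ.hasDerivAt_fisherFlow hν hr Q.inner_cov_self_le_maxCov ht
  refine ⟨J', h1, h2.trans ?_⟩
  rw [← hν.rho_eq ht]
  have h3 : rho ν t ≤ rhoPlus ν t := le_max_left _ _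
  have h4 := fisherFlow_nonneg μ ν t
  gcongr

theorem IsLaw.intervalIntegrable_rhoPlus (hν : Q.IsLaw ν) {a b : ℝ} (ha : 0 < a) (hab : a ≤ b) :
    IntervalIntegrable (rhoPlus ν) volume a b :=
  (hν.continuousOn_rhoPlus.mono fun t ht => by
    rw [Set.uIcc_of_le hab] at ht
    exact ha.trans_le ht.1).intervalIntegrable

theorem IsLaw.fisherFlow_le [IsProbabilityMeasure μ] [IsProbabilityMeasure ν] (hμ : P.IsLaw μ)
    (hν : Q.IsLaw ν) (hr : P.r = Q.r) {α τ : ℝ} (hα : 0 < α) (hα1 : α < 1) (hτ : 0 < τ) :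
    fisherFlow μ ν (τ ^ 2) ≤ 2 / ((1 - α) * τ ^ 2) *
      Real.exp (2 * ∫ s in (α * τ ^ 2)..(τ ^ 2), rhoPlus ν s) * klFlow μ ν (α * τ ^ 2) := by
  have h2 : 0 < τ ^ 2 := pow_pos hτ 2
  have h := le_mul_exp_integral_mul_of_deriv (D := klFlow μ ν) (J := fisherFlow μ ν)
    (mul_pos hα h2) (mul_lt_of_lt_one_left h2 hα1) hν.continuousOn_rhoPlus
    (fun t => le_max_right _ _) ENNReal.toReal_nonneg (fisherFlow_nonneg μ ν)
    (fun t ht => hμ.hasDerivAt_klFlow hν hr ht)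
    (fun t ht => hμ.exists_hasDerivAt_fisherFlow_le hν hr ht)
  rwa [show τ ^ 2 - α * τ ^ 2 = (1 - α) * τ ^ 2 by ring] at h

theorem IsLaw.scoreError_le [IsProbabilityMeasure μ] [IsProbabilityMeasure ν] (hμ : P.IsLaw μ)
    (hν : Q.IsLaw ν) (hr : P.r = Q.r) {R γ D α τ : ℝ} (hR : 0 < R) (hγ : 0 < γ) (hγR : γ < R / 2)
    (hD : 2 ≤ D) (hcov : ∀ z v, inner ℝ (Q.cov z v) v ≤ R ^ 2 * ‖v‖ ^ 2) (hτ : γ ≤ τ)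
    (hα : α = 1 - γ ^ 2 / (R ^ 2 * D ^ 2)) :
    0 < α ∧ scoreError μ ν τ ≤
      2 * Real.exp 1 * R ^ 2 * D ^ 2 / (γ ^ 2 * τ ^ 2) * klFlow μ ν (α * τ ^ 2) := by
  have hτ0 : 0 < τ := hγ.trans_le hτ
  -- From γ < R/2 and D ≥ 2 follows 4γ ≤ RD.
  have hq : γ ^ 2 / (R ^ 2 * D ^ 2) ≤ 1 / 16 := by
    rw [div_le_iff₀ (by positivity), ← mul_pow]
    have : 4 * γ ≤ R * D := by nlinarith
    nlinarith
  have hq0 : 0 < γ ^ 2 / (R ^ 2 * D ^ 2) := by positivity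
  have hα0 : 15 / 16 ≤ α := by linarith
  have hα1 : α < 1 := by linarith
  have hαp : 0 < α := by linarith
  refine ⟨hαp, ?_⟩
  have h2 : 0 < τ ^ 2 := pow_pos hτ0 2
  have hab : α * τ ^ 2 ≤ τ ^ 2 := mul_le_of_le_one_left h2.le hα1.le
  -- R²/s² is largest at the left endpoint; times the interval length this is γ²/(D²α²τ²). Here γ ≤
  -- τ, and Dα ≥ 15/8 gives D²α² ≥ 2.
  have hint : ∫ s in (α * τ ^ 2)..(τ ^ 2), rhoPlus ν s ≤ 1 / 2 := by
    have h1 : ∫ s in (α * τ ^ 2)..(τ ^ 2), rhoPlus ν s ≤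
        ∫ s in (α * τ ^ 2)..(τ ^ 2), R ^ 2 / (α * τ ^ 2) ^ 2 := by
      refine intervalIntegral.integral_mono_on hab
        (hν.intervalIntegrable_rhoPlus (mul_pos hαp h2) hab) (by simp) fun s hs => ?_
      refine (hν.rhoPlus_le hcov ((mul_pos hαp h2).trans_le hs.1)).trans ?_
      have := hs.1
      gcongr
    refine h1.trans ?_
    rw [intervalIntegral.integral_const, smul_eq_mul]
    have h3 : (τ ^ 2 - α * τ ^ 2) * (R ^ 2 / (α * τ ^ 2) ^ 2) = γ ^ 2 / (D ^ 2 * α ^ 2 * τ ^ 2) := by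
      have : τ ^ 2 - α * τ ^ 2 = γ ^ 2 / (R ^ 2 * D ^ 2) * τ ^ 2 := by rw [hα]; ring
      rw [this]
      field_simp
    rw [h3, div_le_iff₀ (by positivity)]
    have h4 : γ ^ 2 ≤ τ ^ 2 := pow_le_pow_left₀ hγ.le hτ 2
    have h5 : 2 ≤ D ^ 2 * α ^ 2 := by
      rw [← mul_pow]
      have : 15 / 8 ≤ D * α := by nlinarith
      nlinarith
    nlinarith
  have hk : 0 ≤ klFlow μ ν (α * τ ^ 2) := ENNReal.toReal_nonneg
  rw [(hμ.scoreError_eq_fisherFlow hν hr hτ0).2]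
  refine (hμ.fisherFlow_le hν hr hαp hα1 hτ0).trans (mul_le_mul_of_nonneg_right ?_ hk)
  have h6 : 2 * Real.exp 1 * R ^ 2 * D ^ 2 / (γ ^ 2 * τ ^ 2) =
      2 / ((1 - α) * τ ^ 2) * Real.exp 1 := by
    rw [hα]
    field_simp
    ring
  rw [h6]
  have h7 : 0 < 1 - α := by linarith
  refine mul_le_mul_of_nonneg_left (Real.exp_le_exp.2 (by linarith)) (by positivity)

end SphereMixture

end KLFisher

/-! ### Assembly of the four statements -/

theorem mainTheorem8 :
    ∃ C : ℝ, 0 < C ∧ ∃ d₀ : ℕ,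
      ∀ (m : ℕ), 0 < m → ∀ (R γ : ℝ), 0 < R → 0 < γ → γ < R / 2 →
      ∀ (n : ℕ), 0 < n → ∀ (S : Fin n → EuclideanSpace ℝ (Fin (2 * m))),
      (∀ i, S i ∈ KLFisher.productCircle m R γ) →
      -- (a): finiteness, the de Bruijn identity, and the Fisher information inequality
      ((∀ t : ℝ, 0 < t →
          InformationTheory.klDiv
              (KLFisher.smoothed (KLFisher.empirical S) (Real.sqrt t))
              (KLFisher.smoothed (KLFisher.nullLaw m R γ) (Real.sqrt t)) ≠ ⊤ ∧
          MeasureTheory.Integrable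
              (KLFisher.fisherIntegrand (KLFisher.empirical S) (KLFisher.nullLaw m R γ) t) ∧
          BddAbove (Set.range (KLFisher.maxCurvature (KLFisher.nullLaw m R γ) t)) ∧
          HasDerivAt (KLFisher.klFlow (KLFisher.empirical S) (KLFisher.nullLaw m R γ))
            (-(1 / 2) * KLFisher.fisherFlow (KLFisher.empirical S) (KLFisher.nullLaw m R γ) t) t) ∧
        ∀ᵐ t ∂(MeasureTheory.volume.restrict (Set.Ioi (0 : ℝ))),
          DifferentiableAt ℝ
              (KLFisher.fisherFlow (KLFisher.empirical S) (KLFisher.nullLaw m R γ)) t ∧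
          deriv (KLFisher.fisherFlow (KLFisher.empirical S) (KLFisher.nullLaw m R γ)) t ≤
            2 * KLFisher.rhoPlus (KLFisher.nullLaw m R γ) t *
              KLFisher.fisherFlow (KLFisher.empirical S) (KLFisher.nullLaw m R γ) t) ∧
      -- (b): the integrated inequality
      (∀ α : ℝ, 0 < α → α < 1 → ∀ τ : ℝ, 0 < τ →
        IntervalIntegrable (KLFisher.rhoPlus (KLFisher.nullLaw m R γ)) MeasureTheory.volume
            (α * τ ^ 2) (τ ^ 2) ∧
        KLFisher.fisherFlow (KLFisher.empirical S) (KLFisher.nullLaw m R γ) (τ ^ 2) ≤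
          2 / ((1 - α) * τ ^ 2) *
            Real.exp (2 * ∫ s in (α * τ ^ 2)..(τ ^ 2),
              KLFisher.rhoPlus (KLFisher.nullLaw m R γ) s) *
            KLFisher.klFlow (KLFisher.empirical S) (KLFisher.nullLaw m R γ) (α * τ ^ 2)) ∧
      -- (c): curvature of the smoothed null law
      (∀ t : ℝ, 0 < t → KLFisher.rhoPlus (KLFisher.nullLaw m R γ) t ≤ R ^ 2 / t ^ 2) ∧
      -- (d): KL control of the score error
      (d₀ ≤ 2 * m → ∀ τ : ℝ, γ ≤ τ → ∀ α τ' : ℝ,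
        α = 1 - γ ^ 2 / (R ^ 2 * ((2 * m : ℕ) : ℝ) ^ 2) → τ' = Real.sqrt α * τ →
        MeasureTheory.Integrable
            (fun x => ‖KLFisher.score (KLFisher.empirical S) τ x -
              KLFisher.score (KLFisher.nullLaw m R γ) τ x‖ ^ 2)
            (KLFisher.smoothed (KLFisher.empirical S) τ) ∧
        InformationTheory.klDiv
            (KLFisher.smoothed (KLFisher.empirical S) τ')
            (KLFisher.smoothed (KLFisher.nullLaw m R γ) τ') ≠ ⊤ ∧
        KLFisher.scoreError (KLFisher.empirical S) (KLFisher.nullLaw m R γ) τ ≤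
          C * R ^ 2 * ((2 * m : ℕ) : ℝ) ^ 2 / (γ ^ 2 * τ ^ 2) *
            (InformationTheory.klDiv
              (KLFisher.smoothed (KLFisher.empirical S) τ')
              (KLFisher.smoothed (KLFisher.nullLaw m R γ) τ')).toReal) := by
  -- The threshold 0 works: the estimate uses only d ≥ 2. The factor e bounds exp(2∫ρ₊).
  refine ⟨2 * Real.exp 1, by positivity, 0, ?_⟩
  intro m hm R γ hR hγ hγR n hn S hS
  have : NeZero (2 * m) := ⟨by omega⟩
  have hSr := fun i => KLFisher.norm_of_mem_productCircle hR (S i) (hS i)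
  have hμ := KLFisher.SphereMixture.isLaw_codebook hn S _ hSr
  have hν := KLFisher.isLaw_nullMixture m hR hγ
  have := KLFisher.isProbabilityMeasure_empirical hn S
  have := KLFisher.isProbabilityMeasure_nullLaw m hR hγ
  have hcov := KLFisher.inner_cov_nullMixture_self_le (m := m) hR hγ
  have hr : (KLFisher.SphereMixture.codebook hn S _ hSr).r =
      (KLFisher.nullMixture m hR hγ).r := rfl
  refine ⟨⟨fun t ht => ⟨(hμ.klDiv_ne_top hν hr ht).1, hμ.integrable_fisherIntegrand hν hr ht,
    hν.bddAbove_maxCurvature ht, hμ.hasDerivAt_klFlow hν hr ht⟩, ?_⟩, ?_, ?_, ?_⟩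
  -- Differentiability of J in fact holds at every t > 0.
  · filter_upwards [ae_restrict_mem measurableSet_Ioi] with t ht
    obtain ⟨J', h1, h2⟩ := hμ.exists_hasDerivAt_fisherFlow_le hν hr ht
    exact ⟨h1.differentiableAt, h1.deriv ▸ h2⟩
  · intro α hα hα1 τ hτ
    have h2 : 0 < τ ^ 2 := pow_pos hτ 2
    exact ⟨hν.intervalIntegrable_rhoPlus (mul_pos hα h2) (mul_le_of_le_one_left h2.le hα1.le),
      hμ.fisherFlow_le hν hr hα hα1 hτ⟩
  · exact fun t ht => hν.rhoPlus_le hcov ht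
  · intro _ τ hτ α τ' hα hτ'
    have hτ0 : 0 < τ := hγ.trans_le hτ
    have hD : (2 : ℝ) ≤ ((2 * m : ℕ) : ℝ) := by exact_mod_cast (by omega : 2 ≤ 2 * m)
    obtain ⟨hα0, h⟩ := hμ.scoreError_le hν hr hR hγ hγR hD hcov hτ hα
    have hs : τ' = √(α * τ ^ 2) := by rw [hτ', Real.sqrt_mul hα0.le, Real.sqrt_sq hτ0.le]
    rw [hs]
    exact ⟨(hμ.scoreError_eq_fisherFlow hν hr hτ0).1,
      (hμ.klDiv_ne_top hν hr (mul_pos hα0 (pow_pos hτ0 2))).1, h⟩
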